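/- Let $1<p<\infty$. A weight on $\mathbb{R}$ is a non-negative locally integrable function $w:\mathbb{R}\to[0,\infty)$. Put $$[w]_{A_p^+}=\sup_{a<b<c}\frac{1}{c-a}\int_a^b w\,\Big(\frac{1}{c-a}\int_b^c w^{-\frac1{p-1}}\Big)^{p-1}\in[0,\infty],$$ where $w^{-\frac1{p-1}}=\infty$ at points where $w=0$, and $0\cdot\infty=0$; write $w\in A_p^+$ if $w$ is a weight and $[w]_{A_p^+}<\infty$. For a locally integrable function $b:\mathbb{R}\to\mathbb{R}$ let $\|b\|_{BMO}=\sup_I\frac1{|I|}\int_I|b-b_I|$, the supremum being over all bounded open non-empty intervals $I\subset\mathbb{R}$, with $b_I=\frac1{|I|}\int_I b$; write $b\in BMO$ if $\|b\|_{BMO}<\infty$. There exist constants $\varepsilon_p>0$ and $C_p>0$, depending only on $p$, such that for every $w\in A_p^+$, every $b\in BMO$ and every $t\in\mathbb{R}$ with $$|t|\le\frac{\varepsilon_p}{[w]_{A_p^+}^{\max\{1,\frac1{p-1}\}}\,\|b\|_{BMO}}$$ (the right-hand side being read as $+\infty$ if the denominator is $0$), one has $e^{tb}w\in A_p^+$ and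 $$[e^{tb}w]_{A_p^+}\le C_p\,[w]_{A_p^+}.$$ -/

import Mathlib

open MeasureTheory
open scoped ENNReal

noncomputable section

namespace OneSided

/-- A weight on the real line: a non-negative locally integrable function. -/
def IsWeight (w : ℝ → ℝ) : Prop :=
  (∀ x, 0 ≤ w x) ∧ LocallyIntegrable w volume

/-- The one-sided constant
`[w]_{A_p^+} = sup_{a<b<c} (1/(c-a)) ∫_a^b w * ((1/(c-a)) ∫_b^c w^{-1/(p-1)})^{p-1}`,
with values in `[0, ∞]`. The negative power of `w` is `∞` where `w` vanishes, and `0 * ∞ = 0`. -/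
def apPlusConst (p : ℝ) (w : ℝ → ℝ) : ℝ≥0∞ :=
  ⨆ (a : ℝ) (b : ℝ) (c : ℝ) (_ : a < b) (_ : b < c),
    ((∫⁻ x in Set.Ioo a b, ENNReal.ofReal (w x)) / ENNReal.ofReal (c - a)) *
      ((∫⁻ x in Set.Ioo b c, ENNReal.ofReal (w x) ^ (-(1 / (p - 1)))) /
        ENNReal.ofReal (c - a)) ^ (p - 1)

/-- The class `A_p^+`, for `p > 1`. -/
def MemApPlus (p : ℝ) (w : ℝ → ℝ) : Prop :=
  IsWeight w ∧ apPlusConst p w < ∞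

/-- The `BMO` seminorm `sup_I (1/|I|) ∫_I |f - f_I|` over bounded open intervals `I`, where `f_I` is
the mean of `f` on `I`. It is meaningful for locally integrable `f`. -/
def bmoNorm (f : ℝ → ℝ) : ℝ≥0∞ :=
  ⨆ (a : ℝ) (c : ℝ) (_ : a < c),
    (∫⁻ x in Set.Ioo a c, ENNReal.ofReal |f x - ⨍ y in Set.Ioo a c, f y|) /
      ENNReal.ofReal (c - a)

/-- Real-valued functions of bounded mean oscillation on the line. -/
def MemBMO (f : ℝ → ℝ) : Prop :=
  LocallyIntegrable f volume ∧ bmoNorm f < ∞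

end OneSided

end

open Set Filter Topology

namespace OneSided

/-! A weight in A_p^+ satisfies a one-sided reverse Hölder inequality with exponent 1 + δ, where δ
is comparable to [w]^(-max(1, 1/(p-1))), and its dual w^(-1/(p-1)) satisfies the reflected one. If
|t| is small compared with δ/‖b‖, the John–Nirenberg inequality controls the conjugate power of
e^{t(b - b_I)}, and of its dual counterpart. By Hölder, passing from w to e^{tb}w then costs the
factor e^{t b_I} for the weight and e^{-t b_I/(p-1)} for the dual, up to absolute constants. With
the same I on both sides these factors cancel in the A_p^+ product.

The one-sided reverse Hölder inequality bounds a power integral by the mass on a longer interval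
(longer to the right for w, to the left for the dual). The product is therefore first estimated on
(x, x+l) and (x+2l, x+4l), where the gap leaves room for both enlargements.
`lintegral_mul_rpow_le_of_gap` then removes the gap without changing the constant.

For the reverse Hölder inequality, a rising sun interval I at height l has mean exactly l and all
averages from its left end at least l. The A_p^+ condition split at the midpoint of I forces {w >
γl} to fill a quarter of I, so the mass of {w > l} is at most 4l|{w > γl}|. Integrating against
l^(δ-1) with δ = γ/32 gives the claim. The requirements Aγ ≲ 1 for w and Aγ^(p-1) ≲ 1 for the dual
are what produces max(1, 1/(p-1)). The same decomposition, applied to |b - b_I|, gives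
John–Nirenberg. -/

/-! ### Rising sun decompositions. -/

/-- The rising sun lemma, from the left: the points of `(a, d)` which are not running minima of `F`
form a countable union of disjoint intervals, at the ends of which `F` takes equal values. -/
theorem exists_rising_sun {F : ℝ → ℝ} (hF : Continuous F) {a d : ℝ}
    (hd : ∀ s ∈ Icc a d, F d ≤ F s) :
    ∃ 𝒞 : Set (ℝ × ℝ), 𝒞.Countable ∧ 𝒞.PairwiseDisjoint (fun I => Ioo I.1 I.2) ∧
      (∀ I ∈ 𝒞, a ≤ I.1 ∧ I.1 < I.2 ∧ I.2 ≤ d ∧ F I.1 = F I.2 ∧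
        ∀ x ∈ Ioo I.1 I.2, F I.1 ≤ F x) ∧
      ∀ x ∈ Ioo a d, (∀ I ∈ 𝒞, x ∉ Ioo I.1 I.2) → ∀ s ∈ Icc a x, F x ≤ F s := by
  set Ω : Set ℝ := {x | x ∈ Ioo a d ∧ ∃ s ∈ Ico a x, F s < F x} with hΩ
  have hΩo : IsOpen Ω := by
    have : Ω = Ioo a d ∩ ⋃ s ∈ Ici a, (Ioi s ∩ {x | F s < F x}) := by
      ext x
      simp only [hΩ, mem_ofPred_eq, mem_inter_iff, mem_iUnion, mem_Ico, mem_Ici, mem_Ioi,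
        exists_prop]
      grind
    rw [this]
    exact isOpen_Ioo.inter (isOpen_biUnion fun s _ =>
      isOpen_Ioi.inter (isOpen_lt continuous_const hF))
  have hmin : ∀ x ∈ Icc a d, x ∉ Ω → ∀ s ∈ Icc a x, F x ≤ F s := by
    intro x hx hxΩ s hs
    by_contra! h
    rcases eq_or_lt_of_le hx.2 with rfl | hxd
    · exact absurd (hd s hs) (not_le.2 h)
    have hsx : s < x := lt_of_le_of_ne hs.2 (by rintro rfl; exact lt_irrefl _ h)
    exact hxΩ ⟨⟨hs.1.trans_lt hsx, hxd⟩, s, ⟨hs.1, hsx⟩, h⟩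
  set 𝒞 : Set (ℝ × ℝ) := {I | I.1 ∈ Icc a d ∧ I.2 ∈ Icc a d ∧ I.1 < I.2 ∧ I.1 ∉ Ω ∧ I.2 ∉ Ω ∧
    Ioo I.1 I.2 ⊆ Ω} with h𝒞
  have hdisj : 𝒞.PairwiseDisjoint (fun I => Ioo I.1 I.2) := by
    rintro ⟨α, β⟩ ⟨-, -, h1, h2, h3, h4⟩ ⟨α', β'⟩ ⟨-, -, h1', h2', h3', h4'⟩ hne
    refine Set.disjoint_left.2 fun x hx hx' => hne ?_
    simp only [mem_Ioo] at *
    have e1 : α = α' := by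
      rcases lt_trichotomy α α' with h | h | h
      · exact absurd (h4 ⟨h, hx'.1.trans hx.2⟩) h2'
      · exact h
      · exact absurd (h4' ⟨h, hx.1.trans hx'.2⟩) h2
    have e2 : β = β' := by
      rcases lt_trichotomy β β' with h | h | h
      · exact absurd (h4' ⟨hx'.1.trans hx.2, h⟩) h3
      · exact h
      · exact absurd (h4 ⟨hx.1.trans hx'.2, h⟩) h3'
    rw [e1, e2]
  have hne : ∀ I ∈ 𝒞, (Ioo I.1 I.2).Nonempty := fun I hI => nonempty_Ioo.2 hI.2.2.1
  refine ⟨𝒞, hdisj.countable_of_isOpen (fun I _ => isOpen_Ioo) hne, hdisj, ?_, ?_⟩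
  · rintro ⟨α, β⟩ ⟨hα, hβ, hlt, hαΩ, hβΩ, hsub⟩
    simp only at *
    have key : ∀ x ∈ Ioo α β, F α ≤ F x := by
      intro x hx
      -- A minimum of `F` over `[a, x]` cannot be attained inside the component, where every point
      -- has a strictly lower earlier value. So it sits at some s ≤ α, and α is a running minimum.
      obtain ⟨s, hs, hsmin⟩ := isCompact_Icc.exists_isMinOn
        (nonempty_Icc.2 (hα.1.trans hx.1.le)) hF.continuousOn
      have hsα : s ≤ α := by
        by_contra! h
        obtain ⟨-, u, hu, hus⟩ := hsub ⟨h, hs.2.trans_lt hx.2⟩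
        exact absurd (hsmin ⟨hu.1, hu.2.le.trans hs.2⟩) (not_le.2 hus)
      exact (hmin α hα hαΩ s ⟨hs.1, hsα⟩).trans
        (hsmin (⟨hα.1.trans hx.1.le, le_rfl⟩ : x ∈ Icc a x))
    refine ⟨hα.1, hlt, hβ.2, le_antisymm ?_ (hmin β hβ hβΩ α ⟨hα.1, hlt.le⟩), key⟩
    have : β ∈ closure (Ioo α β) := by
      rw [closure_Ioo hlt.ne]; exact right_mem_Icc.2 hlt.le
    exact closure_minimal (t := {x | F α ≤ F x}) key (isClosed_le continuous_const hF) this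
  · intro x hx hxC
    refine hmin x (Ioo_subset_Icc_self hx) fun hxΩ => ?_
    have haΩ : a ∉ Ω := fun h => lt_irrefl _ h.1.1
    have hdΩ : d ∉ Ω := fun h => lt_irrefl _ h.1.2
    obtain ⟨α, ⟨hα, hαΩ⟩, hαmax⟩ := (isCompact_Icc.inter_right hΩo.isClosed_compl).exists_isGreatest
      (⟨a, left_mem_Icc.2 hx.1.le, haΩ⟩ : (Icc a x ∩ Ωᶜ).Nonempty)
    obtain ⟨β, ⟨hβ, hβΩ⟩, hβmin⟩ := (isCompact_Icc.inter_right hΩo.isClosed_compl).exists_isLeast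
      (⟨d, right_mem_Icc.2 hx.2.le, hdΩ⟩ : (Icc x d ∩ Ωᶜ).Nonempty)
    have hαx : α < x := lt_of_le_of_ne hα.2 (by rintro rfl; exact hαΩ hxΩ)
    have hxβ : x < β := lt_of_le_of_ne hβ.1 (by rintro rfl; exact hβΩ hxΩ)
    refine hxC (α, β) ⟨⟨hα.1, (hαx.trans hx.2).le⟩, ⟨(hx.1.trans hxβ).le, hβ.2⟩, hαx.trans hxβ,
      hαΩ, hβΩ, fun y hy => ?_⟩ ⟨hαx, hxβ⟩
    by_contra hyΩ
    simp only [mem_Ioo] at hy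
    rcases le_total y x with h | h
    · exact absurd (hαmax ⟨⟨hα.1.trans hy.1.le, h⟩, hyΩ⟩) (not_le.2 hy.1)
    · exact absurd (hβmin ⟨⟨h, hy.2.le.trans hβ.2⟩, hyΩ⟩) (not_le.2 hy.2)

theorem intervalIntegrable_of_locallyIntegrable {f : ℝ → ℝ} (hf : LocallyIntegrable f volume)
    (a b : ℝ) : IntervalIntegrable f volume a b :=
  (hf.integrableOn_isCompact isCompact_uIcc).intervalIntegrable

/-- The rising sun lemma for integrable functions: a one-sided Calderón–Zygmund decomposition at
height `l`. -/
theorem exists_calderonZygmund {f : ℝ → ℝ} (hf : LocallyIntegrable f volume) {a d l : ℝ}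
    (hd : ∀ s ∈ Icc a d, ∫ x in s..d, f x ≤ l * (d - s)) :
    ∃ 𝒞 : Set (ℝ × ℝ), 𝒞.Countable ∧ 𝒞.PairwiseDisjoint (fun I => Ioo I.1 I.2) ∧
      (∀ I ∈ 𝒞, a ≤ I.1 ∧ I.1 < I.2 ∧ I.2 ≤ d ∧ ∫ x in I.1..I.2, f x = l * (I.2 - I.1) ∧
        ∀ x ∈ Ioo I.1 I.2, l * (x - I.1) ≤ ∫ y in I.1..x, f y) ∧
      ∀ᵐ x, x ∈ Ioo a d → (∀ I ∈ 𝒞, x ∉ Ioo I.1 I.2) → f x ≤ l := by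
  have hi := intervalIntegrable_of_locallyIntegrable hf
  set F : ℝ → ℝ := fun x => (∫ y in a..x, f y) - l * x with hFdef
  have hF : Continuous F :=
    (intervalIntegral.continuous_primitive hi a).sub (continuous_const.mul continuous_id)
  have hsub : ∀ s t, F t - F s = (∫ x in s..t, f x) - l * (t - s) := by
    intro s t
    have := intervalIntegral.integral_interval_sub_left (hi a t) (hi a s)
    simp only [hFdef]
    linarith
  obtain ⟨𝒞, h1, h2, h3, h4⟩ := exists_rising_sun hF (a := a) (d := d) (fun s hs => by
    have := hsub s d
    have := hd s hs
    linarith)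
  refine ⟨𝒞, h1, h2, fun I hI => ?_, ?_⟩
  · obtain ⟨ha, hlt, hd', heq, hle⟩ := h3 I hI
    refine ⟨ha, hlt, hd', ?_, fun x hx => ?_⟩
    · have := hsub I.1 I.2
      linarith
    · have := hsub I.1 x
      have := hle x hx
      linarith
  · filter_upwards [_root_.LocallyIntegrable.ae_hasDerivAt_integral hf] with x hx hxad hxC
    have hder : HasDerivAt F (f x - l) x := by
      have h := (hx a).sub ((hasDerivAt_id x).const_mul l)
      rw [mul_one] at h
      exact h
    -- At a running minimum the left difference quotients of `F` are non-positive, so its derivative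
    -- f x - l cannot be positive.
    by_contra! hlx
    have hev : ∀ᶠ y in 𝓝[<] x, F y < F x := by
      have := (hasDerivAt_iff_tendsto_slope.1 hder).eventually (lt_mem_nhds (sub_pos.2 hlx))
      have := this.filter_mono (nhdsWithin_mono x fun y (hy : y < x) => hy.ne)
      filter_upwards [this, self_mem_nhdsWithin] with y hy hyx
      rw [slope_def_field] at hy
      have hyx' : y < x := hyx
      by_contra! hle
      exact absurd (div_nonpos_of_nonneg_of_nonpos (sub_nonneg.2 hle) (sub_neg.2 hyx').le)
        (not_le.2 hy)
    obtain ⟨y, hy, hya⟩ := (hev.and (Ioo_mem_nhdsLT hxad.1)).exists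
    exact absurd (h4 x hxad hxC y ⟨hya.1.le, hya.2.le⟩) (not_le.2 hy)

/-- At a minimum `m` of `x ↦ ∫ₐˣ f - l x` on `[a, e]` the left maximal averages are at most `l`, and
for large `l` this minimum is near `e`. -/
theorem exists_left_averages_le {f : ℝ → ℝ} (hf : LocallyIntegrable f volume) (hf0 : ∀ x, 0 ≤ f x)
    {a d e l : ℝ} (had : a ≤ d) (hde : d < e) (hl : 0 < l) (hle : ∫ x in a..e, f x ≤ l * (e - d)) :
    ∃ m ∈ Icc d e, ∀ s ∈ Icc a m, ∫ x in s..m, f x ≤ l * (m - s) := by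
  have hi := intervalIntegrable_of_locallyIntegrable hf
  set F : ℝ → ℝ := fun x => (∫ y in a..x, f y) - l * x with hFdef
  have hF : Continuous F :=
    (intervalIntegral.continuous_primitive hi a).sub (continuous_const.mul continuous_id)
  obtain ⟨m, hm, hmin⟩ := isCompact_Icc.exists_isMinOn
    (nonempty_Icc.2 (had.trans hde.le)) hF.continuousOn
  have h0 : 0 ≤ ∫ y in a..m, f y := intervalIntegral.integral_nonneg hm.1 fun x _ => hf0 x
  refine ⟨m, ⟨?_, hm.2⟩, fun s hs => ?_⟩
  -- The mass bound gives F e ≤ -l d, while F m ≥ -l m since the integral is non-negative.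
  · have h : F m ≤ F e := hmin (right_mem_Icc.2 (had.trans hde.le))
    simp only [hFdef] at h
    by_contra! hmd
    nlinarith
  · have h : F m ≤ F s := hmin ⟨hs.1, hs.2.trans hm.2⟩
    have := intervalIntegral.integral_interval_sub_left (hi a m) (hi a s)
    simp only [hFdef] at h
    linarith

/-! ### One-sided reverse Hölder inequality. -/

/-- The integral of a non-negative function over an interval, as a lower Lebesgue integral. -/
theorem lintegral_Ioo_ofReal {f : ℝ → ℝ} (hf : LocallyIntegrable f volume) (hf0 : ∀ x, 0 ≤ f x)
    {a b : ℝ} (hab : a ≤ b) :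
    ∫⁻ x in Ioo a b, ENNReal.ofReal (f x) = ENNReal.ofReal (∫ x in a..b, f x) := by
  rw [intervalIntegral.integral_of_le hab, integral_Ioc_eq_integral_Ioo,
    ofReal_integral_eq_lintegral_ofReal _ (ae_of_all _ hf0)]
  exact (hf.integrableOn_isCompact (isCompact_Icc (a := a) (b := b))).mono_set Ioo_subset_Icc_self

/-- A level set estimate: if `{f > γ l}` fills a quarter of every interval whose left averages
are at least `l`, then the mass of `{f > l}` is controlled by the size of `{f > γ l}`. -/
theorem lintegral_superlevel_le {f : ℝ → ℝ} (hf : LocallyIntegrable f volume) (hf0 : ∀ x, 0 ≤ f x)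
    {a m l γ : ℝ} (hl : 0 < l)
    (hm : ∀ s ∈ Icc a m, ∫ x in s..m, f x ≤ l * (m - s))
    (H : ∀ α β, a ≤ α → α < β → β ≤ m → (∀ x ∈ Ioo α β, l * (x - α) ≤ ∫ y in α..x, f y) →
      ENNReal.ofReal ((β - α) / 4) ≤ volume (Ioo α β ∩ {x | γ * l < f x})) :
    ∫⁻ x in Ioo a m ∩ {x | l < f x}, ENNReal.ofReal (f x) ≤
      4 * ENNReal.ofReal l * volume (Ioo a m ∩ {x | γ * l < f x}) := by
  obtain ⟨𝒞, hc, hdisj, hI, hae⟩ := exists_calderonZygmund hf hm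
  set S := {x | γ * l < f x}
  have hmeas : ∀ I ∈ 𝒞, MeasurableSet (Ioo I.1 I.2) := fun _ _ => measurableSet_Ioo
  have hsub : (⋃ I ∈ 𝒞, Ioo I.1 I.2) ⊆ Ioo a m :=
    iUnion₂_subset fun I h => Ioo_subset_Ioo (hI I h).1 (hI I h).2.2.1
  have hU : MeasurableSet (⋃ I ∈ 𝒞, Ioo I.1 I.2) := MeasurableSet.biUnion hc hmeas
  -- Up to a null set {f > l} lies in the rising sun intervals. Each has mass exactly l|I|, which is
  -- at most 4l|I ∩ S|, and the intervals are disjoint.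
  calc ∫⁻ x in Ioo a m ∩ {x | l < f x}, ENNReal.ofReal (f x)
      ≤ ∫⁻ x in ⋃ I ∈ 𝒞, Ioo I.1 I.2, ENNReal.ofReal (f x) := by
        refine lintegral_mono_set' ?_
        filter_upwards [hae] with x hx hxm
        by_contra hxU
        refine absurd (hx hxm.1 fun I h hxI => hxU ?_) (not_le.2 hxm.2)
        exact mem_biUnion h hxI
    _ = ∑' I : 𝒞, ∫⁻ x in Ioo I.1.1 I.1.2, ENNReal.ofReal (f x) :=
        lintegral_biUnion hc hmeas hdisj _
    _ ≤ ∑' I : 𝒞, 4 * ENNReal.ofReal l * volume.restrict S (Ioo I.1.1 I.1.2) := by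
        refine ENNReal.tsum_le_tsum fun I => ?_
        obtain ⟨h1, h2, h3, h4, h5⟩ := hI I.1 I.2
        rw [lintegral_Ioo_ofReal hf hf0 h2.le, h4, Measure.restrict_apply measurableSet_Ioo]
        calc ENNReal.ofReal (l * (I.1.2 - I.1.1))
            = 4 * ENNReal.ofReal l * ENNReal.ofReal ((I.1.2 - I.1.1) / 4) := by
              rw [show (4 : ℝ≥0∞) = ENNReal.ofReal 4 by simp, ← ENNReal.ofReal_mul (by norm_num),
                ← ENNReal.ofReal_mul (by positivity)]
              congr 1; ring
          _ ≤ _ := by gcongr; exact H _ _ h1 h2 h3 h5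
    _ = 4 * ENNReal.ofReal l * volume.restrict S (⋃ I ∈ 𝒞, Ioo I.1 I.2) := by
        rw [ENNReal.tsum_mul_left, measure_biUnion hc hdisj hmeas]
    _ ≤ _ := by
        rw [Measure.restrict_apply hU]
        gcongr

/-- The layer cake argument behind the reverse Hölder inequality. -/
theorem lintegral_rpow_le_of_superlevel {μ : Measure ℝ} {f : ℝ → ℝ}
    (hf : AEMeasurable f μ)
    (hf0 : ∀ x, 0 ≤ f x) (hfi : ∫⁻ x, ENNReal.ofReal (f x) ∂μ ≠ ∞)
    {l₀ γ : ℝ} (hl₀ : 0 < l₀) (hγ : 0 < γ) (hγ1 : γ ≤ 1)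
    (H : ∀ l, l₀ ≤ l → ∫⁻ x in {x | l < f x}, ENNReal.ofReal (f x) ∂μ ≤
      4 * ENNReal.ofReal l * μ {x | γ * l < f x}) :
    ∫⁻ x, ENNReal.ofReal (f x) ^ (1 + γ / 32) ∂μ ≤
      2 * ENNReal.ofReal l₀ ^ (γ / 32) * ∫⁻ x, ENNReal.ofReal (f x) ∂μ := by
  set δ := γ / 32 with hδ
  have hδ0 : 0 < δ := by positivity
  set T := ∫⁻ x, ENNReal.ofReal (f x) ∂μ with hT
  -- the truncated inequality
  have trunc : ∀ N : ℕ, ∫⁻ x, ENNReal.ofReal (f x) * ENNReal.ofReal (min (f x) N ^ δ) ∂μ ≤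
      2 * ENNReal.ofReal l₀ ^ δ * T := by
    intro N
    set g : ℝ → ℝ := fun x => min (f x) N with hg
    have hg0 : ∀ x, 0 ≤ g x := fun x => le_min (hf0 x) (Nat.cast_nonneg N)
    have hgm : AEMeasurable g μ := hf.min aemeasurable_const
    set ν := μ.withDensity fun x => ENNReal.ofReal (f x) with hν
    have hνμ : ν ≪ μ := withDensity_absolutelyContinuous _ _
    set X := ∫⁻ x, ENNReal.ofReal (f x) * ENNReal.ofReal (g x ^ δ) ∂μ with hX
    have hXν : X = ∫⁻ x, ENNReal.ofReal (g x ^ δ) ∂ν := by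
      rw [hν, lintegral_withDensity_eq_lintegral_mul₀ hf.ennreal_ofReal
        (hgm.pow_const δ).ennreal_ofReal]
      rfl
    have hνT : ν univ = T := by rw [hν, withDensity_apply _ MeasurableSet.univ, setLIntegral_univ]
    -- The truncation at `N` serves to make `X` finite, so that half of it can be absorbed at the
    -- end.
    have hXfin : X ≠ ∞ := by
      refine ne_top_of_le_ne_top (ENNReal.mul_ne_top hfi (ENNReal.ofReal_ne_top (r := (N : ℝ) ^ δ)))
        ?_
      rw [hT, ← lintegral_mul_const'' _ hf.ennreal_ofReal]
      refine lintegral_mono fun x => ?_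
      gcongr
      · exact hg0 x
      · exact min_le_right _ _
    -- Below `l₀` the total mass suffices, and above it `H` applies. For l < N truncation does no
    -- harm, because γ l ≤ l < N.
    have hlev : ∀ l ∈ Ioi (0 : ℝ), ν {x | l < g x} * ENNReal.ofReal (l ^ (δ - 1)) ≤
        T * (Iio l₀).indicator (fun l => ENNReal.ofReal (l ^ (δ - 1))) l +
        4 * (μ {x | l < g x / γ} * ENNReal.ofReal (l ^ (1 + δ - 1))) := by
      intro l hl
      have hl : 0 < l := hl
      rcases lt_or_ge l l₀ with h | h
      · refine le_add_right ?_
        rw [indicator_of_mem (show l ∈ Iio l₀ from h), ← hνT]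
        gcongr
        exact subset_univ _
      · refine le_add_left ?_
        rcases le_or_gt (N : ℝ) l with hN | hN
        · have : {x | l < g x} = ∅ := by
            ext x
            have : g x ≤ l := (min_le_right _ _).trans hN
            simpa using this
          simp [this]
        · have hsub : {x | l < g x} ⊆ {x | l < f x} := fun x (hx : l < g x) =>
            show l < f x from lt_of_lt_of_le hx (min_le_left _ _)
          have hsub' : {x | γ * l < f x} ⊆ {x | l < g x / γ} := by
            intro x hx
            have hx' : γ * l < f x := hx
            change l < g x / γ
            rw [lt_div_iff₀ hγ, mul_comm]
            refine lt_min hx' (lt_of_le_of_lt ?_ hN)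
            nlinarith
          have hnull : NullMeasurableSet {x | l < f x} μ :=
            nullMeasurableSet_lt aemeasurable_const hf
          calc ν {x | l < g x} * ENNReal.ofReal (l ^ (δ - 1))
              ≤ ν {x | l < f x} * ENNReal.ofReal (l ^ (δ - 1)) := by gcongr
            _ = (∫⁻ x in {x | l < f x}, ENNReal.ofReal (f x) ∂μ) * ENNReal.ofReal (l ^ (δ - 1)) := by
                rw [hν, withDensity_apply₀ _ hnull]
            _ ≤ (4 * ENNReal.ofReal l * μ {x | l < g x / γ}) * ENNReal.ofReal (l ^ (δ - 1)) := by
                gcongr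
                exact (H l h).trans (by gcongr)
            _ = 4 * (μ {x | l < g x / γ} * (ENNReal.ofReal l * ENNReal.ofReal (l ^ (δ - 1)))) := by
                ring
            _ = _ := by
                rw [← ENNReal.ofReal_mul hl.le, show 1 + δ - 1 = 1 + (δ - 1) by ring,
                  Real.rpow_add hl, Real.rpow_one]
    -- The layer cake formula for the constant `l₀` under a Dirac mass evaluates δ ∫ l^(δ-1) over
    -- (0, l₀).
    have hlow : ENNReal.ofReal δ * ∫⁻ l in Ioi (0 : ℝ),
        (Iio l₀).indicator (fun l => ENNReal.ofReal (l ^ (δ - 1))) l = ENNReal.ofReal l₀ ^ δ := by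
      have := lintegral_rpow_eq_lintegral_meas_lt_mul (Measure.dirac (0 : ℝ))
        (f := fun _ => l₀) (ae_of_all _ fun _ => hl₀.le) aemeasurable_const hδ0
      rw [lintegral_const, measure_univ, mul_one] at this
      rw [ENNReal.ofReal_rpow_of_pos hl₀, this]
      congr 1
      refine lintegral_congr fun l => ?_
      by_cases h : l < l₀
      · simp [h]
      · simp [h]
    have hhigh : ENNReal.ofReal (1 + δ) * ∫⁻ l in Ioi (0 : ℝ),
        μ {x | l < g x / γ} * ENNReal.ofReal (l ^ (1 + δ - 1)) ≤
        ENNReal.ofReal (γ⁻¹ ^ (1 + δ)) * X := by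
      rw [← lintegral_rpow_eq_lintegral_meas_lt_mul μ (f := fun x => g x / γ)
        (ae_of_all _ fun x => div_nonneg (hg0 x) hγ.le) (hgm.div_const γ) (by positivity), hX,
        ← lintegral_const_mul' _ _ ENNReal.ofReal_ne_top]
      refine lintegral_mono fun x => ?_
      rw [← ENNReal.ofReal_mul (hf0 x), ← ENNReal.ofReal_mul (by positivity), div_eq_inv_mul,
        Real.mul_rpow (by positivity) (hg0 x)]
      refine ENNReal.ofReal_le_ofReal ?_
      gcongr
      rcases (hg0 x).eq_or_lt with h | h
      · rw [← h, Real.zero_rpow (by positivity), Real.zero_rpow hδ0.ne', mul_zero]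
      · rw [Real.rpow_add h, Real.rpow_one]
        gcongr
        exact min_le_left _ _
    -- Here the 32 in δ = γ/32 is used: γ^(-δ) ≤ e < 3, so the left side is at most 12/32.
    have hconst : δ * 4 * γ⁻¹ ^ (1 + δ) ≤ 1 / 2 := by
      have h1 : γ⁻¹ ^ δ ≤ 3 := by
        rw [Real.rpow_def_of_pos (by positivity)]
        refine (Real.exp_le_exp.2 (?_ : _ ≤ (1 : ℝ))).trans Real.exp_one_lt_three.le
        have := Real.log_le_sub_one_of_pos (inv_pos.2 hγ)
        have h2 : (γ⁻¹ - 1) * δ ≤ 1 := by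
          rw [hδ]; field_simp; linarith
        exact (mul_le_mul_of_nonneg_right this hδ0.le).trans h2
      rw [Real.rpow_add (by positivity), Real.rpow_one]
      calc δ * 4 * (γ⁻¹ * γ⁻¹ ^ δ) ≤ δ * 4 * (γ⁻¹ * 3) := by gcongr
        _ ≤ 1 / 2 := by rw [hδ]; field_simp; norm_num
    have hmain : X ≤ ENNReal.ofReal l₀ ^ δ * T + 2⁻¹ * X := by
      calc X = ENNReal.ofReal δ * ∫⁻ l in Ioi (0 : ℝ),
            ν {x | l < g x} * ENNReal.ofReal (l ^ (δ - 1)) := by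
            rw [hXν, lintegral_rpow_eq_lintegral_meas_lt_mul ν (ae_of_all _ hg0)
              (hgm.mono_ac hνμ) hδ0]
        _ ≤ ENNReal.ofReal δ * ∫⁻ l in Ioi (0 : ℝ),
            (T * (Iio l₀).indicator (fun l => ENNReal.ofReal (l ^ (δ - 1))) l +
              4 * (μ {x | l < g x / γ} * ENNReal.ofReal (l ^ (1 + δ - 1)))) := by
            gcongr 1
            exact setLIntegral_mono' measurableSet_Ioi hlev
        _ = T * (ENNReal.ofReal δ * ∫⁻ l in Ioi (0 : ℝ),
              (Iio l₀).indicator (fun l => ENNReal.ofReal (l ^ (δ - 1))) l) +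
            ENNReal.ofReal δ * 4 * ∫⁻ l in Ioi (0 : ℝ),
              μ {x | l < g x / γ} * ENNReal.ofReal (l ^ (1 + δ - 1)) := by
            have hmi : Measurable fun l : ℝ =>
                (Iio l₀).indicator (fun l => ENNReal.ofReal (l ^ (δ - 1))) l :=
              Measurable.indicator (by fun_prop) measurableSet_Iio
            rw [lintegral_add_left (hmi.const_mul T), lintegral_const_mul _ hmi,
              lintegral_const_mul' _ _ (by simp)]
            ring
        _ ≤ T * ENNReal.ofReal l₀ ^ δ + ENNReal.ofReal δ * 4 * (ENNReal.ofReal (1 + δ) *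
              ∫⁻ l in Ioi (0 : ℝ), μ {x | l < g x / γ} * ENNReal.ofReal (l ^ (1 + δ - 1))) := by
            rw [hlow]
            gcongr
            refine le_mul_of_one_le_left zero_le ?_
            rw [← ENNReal.ofReal_one]
            exact ENNReal.ofReal_le_ofReal (by linarith)
        _ ≤ T * ENNReal.ofReal l₀ ^ δ +
            ENNReal.ofReal δ * 4 * (ENNReal.ofReal (γ⁻¹ ^ (1 + δ)) * X) := by gcongr
        _ ≤ _ := by
            rw [mul_comm T, ← mul_assoc (ENNReal.ofReal δ * 4)]
            gcongr
            rw [show (4 : ℝ≥0∞) = ENNReal.ofReal 4 by simp, ← ENNReal.ofReal_mul hδ0.le,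
              ← ENNReal.ofReal_mul (by positivity),
              show (2⁻¹ : ℝ≥0∞) = ENNReal.ofReal (1 / 2) by
                rw [one_div, ENNReal.ofReal_inv_of_pos two_pos]; simp]
            exact ENNReal.ofReal_le_ofReal hconst
    have hhalf : 2⁻¹ * X ≤ ENNReal.ofReal l₀ ^ δ * T := by
      have h2 : X = 2⁻¹ * X + 2⁻¹ * X := by
        rw [← add_mul, ENNReal.inv_two_add_inv_two, one_mul]
      have h3 : 2⁻¹ * X ≠ ∞ := ENNReal.mul_ne_top (by simp) hXfin
      exact (ENNReal.add_le_add_iff_right h3).1 (h2.symm.trans_le hmain)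
    calc X = 2 * (2⁻¹ * X) := by
          rw [← mul_assoc, ENNReal.mul_inv_cancel two_ne_zero ENNReal.ofNat_ne_top, one_mul]
      _ ≤ 2 * (ENNReal.ofReal l₀ ^ δ * T) := by gcongr
      _ = _ := by ring
  -- monotone convergence
  have hmono : ∀ x, Monotone fun N : ℕ =>
      ENNReal.ofReal (f x) * ENNReal.ofReal (min (f x) N ^ δ) := by
    intro x N M hNM
    dsimp only
    gcongr
    exact le_min (hf0 x) (Nat.cast_nonneg N)
  have hlim : ∀ x, Tendsto (fun N : ℕ =>
      ENNReal.ofReal (f x) * ENNReal.ofReal (min (f x) N ^ δ)) atTop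
      (𝓝 (ENNReal.ofReal (f x) ^ (1 + δ))) := by
    intro x
    obtain ⟨M, hM⟩ := exists_nat_ge (f x)
    refine tendsto_atTop_of_eventually_const (i₀ := M) fun N hN => ?_
    rw [min_eq_left (hM.trans (Nat.cast_le.2 hN)), ← ENNReal.ofReal_rpow_of_nonneg (hf0 x) hδ0.le,
      ENNReal.rpow_add_of_nonneg _ _ zero_le_one hδ0.le, ENNReal.rpow_one]
  refine le_of_tendsto' (lintegral_tendsto_of_tendsto_of_monotone
    (fun N => hf.ennreal_ofReal.mul ((hf.min aemeasurable_const).pow_const δ).ennreal_ofReal)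
    (ae_of_all _ hmono) (ae_of_all _ hlim)) trunc

/-- A one-sided reverse Hölder inequality. -/
theorem reverse_holder {f : ℝ → ℝ} (hf : LocallyIntegrable f volume) (hf0 : ∀ x, 0 ≤ f x)
    {a d e γ : ℝ} (had : a < d) (hde : d < e) (hγ : 0 < γ) (hγ1 : γ ≤ 1)
    (H : ∀ α β l, a ≤ α → α < β → β ≤ e → 0 < l →
      (∀ x ∈ Ioo α β, l * (x - α) ≤ ∫ y in α..x, f y) →
      ENNReal.ofReal ((β - α) / 4) ≤ volume (Ioo α β ∩ {x | γ * l < f x})) :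
    ∫⁻ x in Ioo a d, ENNReal.ofReal (f x) ^ (1 + γ / 32) ≤
      2 * ((∫⁻ x in Ioo a e, ENNReal.ofReal (f x)) / ENNReal.ofReal (e - d)) ^ (γ / 32) *
        ∫⁻ x in Ioo a e, ENNReal.ofReal (f x) := by
  have hae := had.trans hde
  have hed : 0 < e - d := sub_pos.2 hde
  have hfm := hf.aestronglyMeasurable.aemeasurable
  set V := ∫ x in a..e, f x with hV
  have hV0 : 0 ≤ V := intervalIntegral.integral_nonneg hae.le fun x _ => hf0 x
  have hVe := lintegral_Ioo_ofReal hf hf0 hae.le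
  rcases hV0.eq_or_lt with h0 | hVpos
  · have h1 : ∫⁻ x in Ioo a e, ENNReal.ofReal (f x) = 0 := by rw [hVe, ← hV, ← h0]; simp
    rw [lintegral_eq_zero_iff' hfm.ennreal_ofReal.restrict] at h1
    have h2 : ∫⁻ x in Ioo a d, ENNReal.ofReal (f x) ^ (1 + γ / 32) = 0 := by
      rw [lintegral_eq_zero_iff' (hfm.ennreal_ofReal.restrict.pow_const _)]
      filter_upwards [ae_restrict_of_ae_restrict_of_subset (Ioo_subset_Ioo_right hde.le) h1]
        with x hx
      rw [hx]
      simp only [Pi.zero_apply]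
      exact ENNReal.zero_rpow_of_pos (by positivity)
    rw [h2]
    exact zero_le
  -- This is the lowest height for which the mass condition of `exists_left_averages_le` holds, with
  -- equality.
  · have hl₀ : 0 < V / (e - d) := by positivity
    obtain ⟨m, hm, hmle⟩ := exists_left_averages_le hf hf0 had.le hde hl₀
      (by rw [div_mul_cancel₀ _ hed.ne'])
    have hfin : ∫⁻ x in Ioo a m, ENNReal.ofReal (f x) ≠ ∞ := by
      rw [lintegral_Ioo_ofReal hf hf0 (had.le.trans hm.1)]; exact ENNReal.ofReal_ne_top
    have key := lintegral_rpow_le_of_superlevel (μ := volume.restrict (Ioo a m)) hfm.restrict hf0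
      hfin hl₀ hγ hγ1 (fun l hl => by
        have hlpos : 0 < l := hl₀.trans_le hl
        have := lintegral_superlevel_le (γ := γ) hf hf0 hlpos (a := a) (m := m)
          (fun s hs => (hmle s hs).trans (by
            have := sub_nonneg.2 hs.2
            gcongr))
          (fun α β h1 h2 h3 h4 => H α β l h1 h2 (h3.trans hm.2) hlpos h4)
        have hn : NullMeasurableSet {x | l < f x} (volume.restrict (Ioo a m)) :=
          nullMeasurableSet_lt aemeasurable_const hfm.restrict
        have hn' : NullMeasurableSet {x | γ * l < f x} (volume.restrict (Ioo a m)) :=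
          nullMeasurableSet_lt aemeasurable_const hfm.restrict
        rw [Measure.restrict_restrict₀ hn, Measure.restrict_apply₀ hn', inter_comm,
          inter_comm _ (Ioo a m)]
        exact this)
    calc ∫⁻ x in Ioo a d, ENNReal.ofReal (f x) ^ (1 + γ / 32)
        ≤ ∫⁻ x in Ioo a m, ENNReal.ofReal (f x) ^ (1 + γ / 32) :=
          lintegral_mono_set (Ioo_subset_Ioo_right hm.1)
      _ ≤ _ := key
      _ ≤ _ := by
          rw [hVe, ← ENNReal.ofReal_div_of_pos hed, ← hVe]
          gcongr
          exact hm.2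

/-! ### Reflection of the reverse Hölder inequality. -/

theorem locallyIntegrable_comp_neg {f : ℝ → ℝ} (hf : LocallyIntegrable f volume) :
    LocallyIntegrable (fun x => f (-x)) volume := by
  have h := (locallyIntegrable_map_homeomorph (Homeomorph.neg ℝ) (f := f) (μ := volume)).1
  rw [show Measure.map (Homeomorph.neg ℝ) volume = (volume : Measure ℝ) from
    (Measure.measurePreserving_neg volume).map_eq] at h
  exact h hf

theorem setLIntegral_Ioo_comp_neg (f : ℝ → ℝ≥0∞) (a b : ℝ) :
    ∫⁻ x in Ioo (-b) (-a), f (-x) = ∫⁻ x in Ioo a b, f x := by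
  have h := (Measure.measurePreserving_neg (volume : Measure ℝ)).setLIntegral_comp_preimage_emb
    (Homeomorph.neg ℝ).measurableEmbedding f (Ioo a b)
  rw [← h]
  congr 2
  ext x
  simp only [mem_Ioo, mem_preimage]
  constructor <;> rintro ⟨h1, h2⟩ <;> constructor <;> linarith

/-- The reverse Hölder inequality `reverse_holder`, reflected. -/
theorem reverse_holder_reflected {f : ℝ → ℝ} (hf : LocallyIntegrable f volume) (hf0 : ∀ x, 0 ≤ f x)
    {a d e γ : ℝ} (had : a < d) (hde : d < e) (hγ : 0 < γ) (hγ1 : γ ≤ 1)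
    (H : ∀ α β l, a ≤ α → α < β → β ≤ e → 0 < l →
      (∀ x ∈ Ioo α β, l * (β - x) ≤ ∫ y in x..β, f y) →
      ENNReal.ofReal ((β - α) / 4) ≤ volume (Ioo α β ∩ {x | γ * l < f x})) :
    ∫⁻ x in Ioo d e, ENNReal.ofReal (f x) ^ (1 + γ / 32) ≤
      2 * ((∫⁻ x in Ioo a e, ENNReal.ofReal (f x)) / ENNReal.ofReal (d - a)) ^ (γ / 32) *
        ∫⁻ x in Ioo a e, ENNReal.ofReal (f x) := by
  have h := reverse_holder (f := fun x => f (-x)) (locallyIntegrable_comp_neg hf) (fun x => hf0 _)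
    (neg_lt_neg hde) (neg_lt_neg had) hγ hγ1 (fun α β l h1 h2 h3 hl hle => by
      have key := H (-β) (-α) l (by linarith) (by linarith) (by linarith) hl (fun x hx => by
        have := hle (-x) ⟨by linarith [hx.2], by linarith [hx.1]⟩
        rw [intervalIntegral.integral_comp_neg, neg_neg] at this
        convert this using 1
        ring)
      have hv : volume (Ioo α β ∩ {x | γ * l < f (-x)}) =
          volume (Ioo (-β) (-α) ∩ {x | γ * l < f x}) := by
        rw [← Measure.measure_preimage_neg volume (Ioo (-β) (-α) ∩ {x | γ * l < f x})]
        congr 1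
        ext x
        simp only [mem_inter_iff, mem_Ioo, mem_preimage, mem_ofPred_eq, neg_lt_neg_iff]
        tauto
      rw [hv]
      convert key using 2
      ring)
  rw [setLIntegral_Ioo_comp_neg (fun x => ENNReal.ofReal (f x) ^ (1 + γ / 32)),
    setLIntegral_Ioo_comp_neg (fun x => ENNReal.ofReal (f x)),
    show -a - -d = d - a by ring] at h
  exact h

/-! ### BMO and the John–Nirenberg inequality. -/

/-- The mean over an interval. -/
theorem mul_average_Ioo (g : ℝ → ℝ) {a e : ℝ} (hae : a < e) :
    (e - a) * (⨍ y in Ioo a e, g y) = ∫ y in a..e, g y := by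
  rw [setAverage_eq, intervalIntegral.integral_of_le hae.le, integral_Ioc_eq_integral_Ioo,
    Measure.real, Real.volume_Ioo, ENNReal.toReal_ofReal (sub_pos.2 hae).le, smul_eq_mul,
    mul_inv_cancel_left₀ (sub_pos.2 hae).ne']

theorem abs_average_sub_le {g : ℝ → ℝ} (hg : LocallyIntegrable g volume) {a e : ℝ} (hae : a < e)
    (c : ℝ) : (e - a) * |(⨍ y in Ioo a e, g y) - c| ≤ ∫ y in a..e, |g y - c| := by
  have hi := intervalIntegrable_of_locallyIntegrable hg a e
  calc (e - a) * |(⨍ y in Ioo a e, g y) - c|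
      = |∫ y in a..e, (g y - c)| := by
        nth_rewrite 1 [← abs_of_pos (sub_pos.2 hae)]
        rw [← abs_mul, mul_sub, mul_average_Ioo g hae,
          intervalIntegral.integral_sub hi intervalIntegrable_const, intervalIntegral.integral_const, smul_eq_mul]
    _ ≤ _ := intervalIntegral.abs_integral_le_integral_abs hae.le

theorem locallyIntegrable_abs_sub_const {g : ℝ → ℝ} (hg : LocallyIntegrable g volume) (c : ℝ) :
    LocallyIntegrable (fun x => |g x - c|) volume := by
  intro x
  obtain ⟨s, hs, hi⟩ := (hg.sub (locallyIntegrable_const c)) x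
  exact ⟨s, hs, Integrable.norm hi⟩

theorem le_bmoNorm (b : ℝ → ℝ) {a c : ℝ} (hac : a < c) :
    (∫⁻ x in Ioo a c, ENNReal.ofReal |b x - ⨍ y in Ioo a c, b y|) / ENNReal.ofReal (c - a) ≤
      bmoNorm b := by
  unfold bmoNorm
  exact le_iSup_of_le a (le_iSup_of_le c (le_iSup_of_le hac le_rfl))

theorem bmoNorm_mul_le {b : ℝ → ℝ} (u : ℝ) :
    bmoNorm (fun x => u * b x) ≤ ENNReal.ofReal |u| * bmoNorm b := by
  refine iSup_le fun a => iSup_le fun c => iSup_le fun hac => ?_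
  have h : ∫⁻ x in Ioo a c, ENNReal.ofReal |u * b x - ⨍ y in Ioo a c, u * b y| =
      ENNReal.ofReal |u| * ∫⁻ x in Ioo a c, ENNReal.ofReal |b x - ⨍ y in Ioo a c, b y| := by
    rw [← lintegral_const_mul' _ _ ENNReal.ofReal_ne_top]
    refine lintegral_congr fun x => ?_
    rw [← ENNReal.ofReal_mul (abs_nonneg u), ← abs_mul, mul_sub]
    congr 3
    rw [setAverage_eq, setAverage_eq, integral_const_mul, smul_eq_mul, smul_eq_mul]
    ring
  rw [h, mul_div_assoc]
  gcongr
  exact le_bmoNorm b hac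

theorem integral_abs_sub_average_le {g : ℝ → ℝ} (hg : LocallyIntegrable g volume) {B : ℝ}
    (hB : 0 ≤ B) (hgB : bmoNorm g ≤ ENNReal.ofReal B) {a e : ℝ} (hae : a < e) :
    ∫ y in a..e, |g y - ⨍ y in Ioo a e, g y| ≤ B * (e - a) := by
  have hea : 0 < e - a := sub_pos.2 hae
  have h1 : (∫⁻ x in Ioo a e, ENNReal.ofReal |g x - ⨍ y in Ioo a e, g y|) /
      ENNReal.ofReal (e - a) ≤ ENNReal.ofReal B :=
    (le_bmoNorm g hae).trans hgB
  rw [ENNReal.div_le_iff (by simpa using hae) ENNReal.ofReal_ne_top,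
    lintegral_Ioo_ofReal (f := fun x => |g x - ⨍ y in Ioo a e, g y|)
      (locallyIntegrable_abs_sub_const hg _) (fun x => abs_nonneg _) hae.le,
    ← ENNReal.ofReal_mul hB] at h1
  exact (ENNReal.ofReal_le_ofReal_iff (by positivity)).1 h1

/-- One step in the proof of the John–Nirenberg inequality. -/
theorem john_nirenberg_step {g : ℝ → ℝ} (hg : LocallyIntegrable g volume)
    (hgB : bmoNorm g ≤ ENNReal.ofReal (1 / 20)) {r : ℝ}
    (ih : ∀ a e : ℝ, a < e → ∫⁻ x in Ioo a e,
      ENNReal.ofReal (Real.exp (min |g x - ⨍ y in Ioo a e, g y| r)) ≤ 12 * ENNReal.ofReal (e - a))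
    {a e : ℝ} (hae : a < e) :
    ∫⁻ x in Ioo a e, ENNReal.ofReal (Real.exp (min |g x - ⨍ y in Ioo a e, g y| (r + 3 / 10))) ≤
      12 * ENNReal.ofReal (e - a) := by
  have hea : 0 < e - a := sub_pos.2 hae
  -- Doubling the interval makes room for an endpoint m ≥ e at which all left averages of `f` are at
  -- most 1/5.
  obtain ⟨e', he'⟩ : ∃ e', e' = 2 * e - a := ⟨_, rfl⟩
  have hee' : e < e' := by linarith
  have hae' : a < e' := by linarith
  set A := ⨍ y in Ioo a e, g y
  set A' := ⨍ y in Ioo a e', g y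
  set f : ℝ → ℝ := fun x => |g x - A'| with hfdef
  have hf : LocallyIntegrable f volume := locallyIntegrable_abs_sub_const hg _
  have hf0 : ∀ x, 0 ≤ f x := fun x => abs_nonneg _
  have hi := intervalIntegrable_of_locallyIntegrable hf
  have hosc : ∫ y in a..e', f y ≤ 1 / 10 * (e - a) := by
    have := integral_abs_sub_average_le hg (by norm_num) hgB hae'
    exact this.trans (by linarith)
  have hAA' : |A - A'| ≤ 1 / 10 := by
    have h1 := abs_average_sub_le hg hae A'
    have h2 : ∫ y in a..e, f y ≤ ∫ y in a..e', f y :=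
      intervalIntegral.integral_mono_interval le_rfl hae.le hee'.le (ae_of_all _ hf0) (hi a e')
    have h3 : (e - a) * |A - A'| ≤ (e - a) * (1 / 10) := by
      refine h1.trans (h2.trans ?_)
      linarith
    exact le_of_mul_le_mul_left h3 hea
  obtain ⟨m, hm, hmle⟩ := exists_left_averages_le hf hf0 hae.le hee' (l := 1 / 5) (by norm_num)
    (hosc.trans (by linarith))
  obtain ⟨𝒞, hc, hdisj, hI, hout⟩ := exists_calderonZygmund hf hmle
  have hmeas : ∀ I ∈ 𝒞, MeasurableSet (Ioo I.1 I.2) := fun _ _ => measurableSet_Ioo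
  set U := ⋃ I ∈ 𝒞, Ioo I.1 I.2 with hUdef
  have hU : MeasurableSet U := MeasurableSet.biUnion hc hmeas
  have hsub : U ⊆ Ioo a e' :=
    iUnion₂_subset fun I h => Ioo_subset_Ioo (hI I h).1 ((hI I h).2.2.1.trans hm.2)
  -- Each interval has mean 1/5 and the total mass is at most (e - a)/10, so the lengths add up to
  -- at most half of e - a.
  have hsum : ∑' I : 𝒞, ENNReal.ofReal (I.1.2 - I.1.1) ≤ ENNReal.ofReal ((e - a) / 2) := by
    have h1 : ENNReal.ofReal (1 / 5) * ∑' I : 𝒞, ENNReal.ofReal (I.1.2 - I.1.1) ≤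
        ENNReal.ofReal (1 / 5) * ENNReal.ofReal ((e - a) / 2) := by
      calc ENNReal.ofReal (1 / 5) * ∑' I : 𝒞, ENNReal.ofReal (I.1.2 - I.1.1)
          = ∑' I : 𝒞, ∫⁻ x in Ioo I.1.1 I.1.2, ENNReal.ofReal (f x) := by
            rw [← ENNReal.tsum_mul_left]
            congr 1
            ext I
            obtain ⟨h1, h2, h3, h4, -⟩ := hI I.1 I.2
            rw [lintegral_Ioo_ofReal hf hf0 h2.le, h4, ENNReal.ofReal_mul (by norm_num)]
        _ = ∫⁻ x in U, ENNReal.ofReal (f x) := (lintegral_biUnion hc hmeas hdisj _).symm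
        _ ≤ ∫⁻ x in Ioo a e', ENNReal.ofReal (f x) := lintegral_mono_set hsub
        _ = ENNReal.ofReal (∫ y in a..e', f y) := lintegral_Ioo_ofReal hf hf0 hae'.le
        _ ≤ ENNReal.ofReal (1 / 5 * ((e - a) / 2)) :=
            ENNReal.ofReal_le_ofReal (hosc.trans (by linarith))
        _ = _ := ENNReal.ofReal_mul (by norm_num)
    exact (ENNReal.mul_le_mul_iff_right (by norm_num) ENNReal.ofReal_ne_top).1 h1
  set Φ : ℝ → ℝ≥0∞ := fun x => ENNReal.ofReal (Real.exp (min |g x - A| (r + 3 / 10)))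
  set K := ENNReal.ofReal (Real.exp (3 / 10)) with hK
  -- The mean over a stopping interval differs from `A'` by at most 1/5, and `A'` from `A` by at
  -- most 1/10. Recentring therefore costs 3/10, which is the rise in the truncation height.
  have hin : ∫⁻ x in U, Φ x ≤ K * (12 * ENNReal.ofReal ((e - a) / 2)) := by
    rw [lintegral_biUnion hc hmeas hdisj]
    calc ∑' I : 𝒞, ∫⁻ x in Ioo I.1.1 I.1.2, Φ x
        ≤ ∑' I : 𝒞, K * (12 * ENNReal.ofReal (I.1.2 - I.1.1)) := by
          refine ENNReal.tsum_le_tsum fun I => ?_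
          obtain ⟨h1, h2, h3, h4, -⟩ := hI I.1 I.2
          refine le_trans ?_ (mul_le_mul_right (ih _ _ h2) K)
          rw [← lintegral_const_mul' _ _ ENNReal.ofReal_ne_top]
          refine lintegral_mono fun x => ?_
          rw [← ENNReal.ofReal_mul (Real.exp_pos _).le, ← Real.exp_add]
          refine ENNReal.ofReal_le_ofReal (Real.exp_le_exp.2 ?_)
          set A'' := ⨍ y in Ioo I.1.1 I.1.2, g y
          have hA'' : |A'' - A'| ≤ 1 / 5 := by
            have h5 := abs_average_sub_le hg h2 A'
            have h6 : (I.1.2 - I.1.1) * |A'' - A'| ≤ (I.1.2 - I.1.1) * (1 / 5) := by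
              refine h5.trans (h4.le.trans ?_)
              linarith
            exact le_of_mul_le_mul_left h6 (sub_pos.2 h2)
          have h7 : |g x - A| ≤ |g x - A''| + 3 / 10 := by
            have e1 := abs_sub_le (g x) A'' A
            have e2 := abs_sub_le A'' A' A
            rw [abs_sub_comm A' A] at e2
            linarith
          rcases le_total |g x - A''| r with h | h
          · rw [min_eq_left h]
            exact (min_le_left _ _).trans (by linarith)
          · rw [min_eq_right h]
            exact (min_le_right _ _).trans (by linarith)
      _ = K * (12 * ∑' I : 𝒞, ENNReal.ofReal (I.1.2 - I.1.1)) := by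
          rw [ENNReal.tsum_mul_left, ENNReal.tsum_mul_left]
      _ ≤ _ := by gcongr
  have hoff : ∫⁻ x in Ioo a m \ U, Φ x ≤ K * ENNReal.ofReal (2 * (e - a)) := by
    calc ∫⁻ x in Ioo a m \ U, Φ x ≤ ∫⁻ x in Ioo a m \ U, K := by
          refine setLIntegral_mono_ae' (measurableSet_Ioo.diff hU) ?_
          filter_upwards [hout] with x hx hxU
          refine ENNReal.ofReal_le_ofReal (Real.exp_le_exp.2 ((min_le_left _ _).trans ?_))
          have h1 : |g x - A'| ≤ 1 / 5 :=
            hx hxU.1 fun I hI' hxI => hxU.2 (mem_biUnion hI' hxI)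
          have e1 := abs_sub_le (g x) A' A
          rw [abs_sub_comm A' A] at e1
          linarith
      _ = K * volume (Ioo a m \ U) := setLIntegral_const _ _
      _ ≤ K * volume (Ioo a m) := by gcongr; exact sdiff_subset
      _ ≤ _ := by
          rw [Real.volume_Ioo]
          gcongr
          linarith [hm.2]
  -- This closes the induction: the intervals contribute 12/2 and the rest 2, and (3/2)(6 + 2) = 12.
  have hexp : Real.exp (3 / 10) ≤ 3 / 2 := by
    have h := Real.one_sub_le_exp_neg (3 / 10)
    rw [Real.exp_neg] at h
    have h2 : (Real.exp (3 / 10)) * (1 - 3 / 10) ≤ 1 := by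
      calc _ ≤ Real.exp (3 / 10) * (Real.exp (3 / 10))⁻¹ := by gcongr
        _ = 1 := mul_inv_cancel₀ (Real.exp_pos _).ne'
    nlinarith
  calc ∫⁻ x in Ioo a e, Φ x ≤ ∫⁻ x in U ∪ (Ioo a m \ U), Φ x := by
        refine lintegral_mono_set ?_
        rw [union_sdiff_self]
        exact (Ioo_subset_Ioo_right hm.1).trans subset_union_right
    _ ≤ (∫⁻ x in U, Φ x) + ∫⁻ x in Ioo a m \ U, Φ x := lintegral_union_le _ _ _
    _ ≤ K * (12 * ENNReal.ofReal ((e - a) / 2)) + K * ENNReal.ofReal (2 * (e - a)) :=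
        add_le_add hin hoff
    _ ≤ _ := by
        rw [hK, show (12 : ℝ≥0∞) = ENNReal.ofReal 12 by simp, ← ENNReal.ofReal_mul (by positivity),
          ← ENNReal.ofReal_mul (by positivity), ← ENNReal.ofReal_mul (by positivity),
          ← ENNReal.ofReal_mul (by positivity), ← ENNReal.ofReal_add (by positivity)
            (by positivity)]
        refine ENNReal.ofReal_le_ofReal ?_
        nlinarith

/-- The John–Nirenberg inequality. -/
theorem john_nirenberg {g : ℝ → ℝ} (hg : LocallyIntegrable g volume)
    (hgB : bmoNorm g ≤ ENNReal.ofReal (1 / 20)) {a e : ℝ} (hae : a < e) :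
    ∫⁻ x in Ioo a e, ENNReal.ofReal (Real.exp |g x - ⨍ y in Ioo a e, g y|) ≤
      12 * ENNReal.ofReal (e - a) := by
  -- Truncating the oscillation makes the start of the induction trivial; monotone convergence
  -- removes the truncation.
  have main : ∀ n : ℕ, ∀ a e : ℝ, a < e → ∫⁻ x in Ioo a e,
      ENNReal.ofReal (Real.exp (min |g x - ⨍ y in Ioo a e, g y| (n * (3 / 10)))) ≤
        12 * ENNReal.ofReal (e - a) := by
    intro n
    induction n with
    | zero =>
      intro a e hae
      calc _ = ∫⁻ x in Ioo a e, 1 := by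
            refine lintegral_congr fun x => ?_
            rw [Nat.cast_zero, zero_mul, min_eq_right (abs_nonneg _), Real.exp_zero,
              ENNReal.ofReal_one]
        _ ≤ _ := by
            rw [setLIntegral_const, Real.volume_Ioo]
            gcongr
            norm_num
    | succ n ih =>
      intro a e hae
      have := john_nirenberg_step hg hgB ih hae
      rw [show ((n + 1 : ℕ) : ℝ) * (3 / 10) = n * (3 / 10) + 3 / 10 by push_cast; ring]
      exact this
  have hgm := hg.aestronglyMeasurable.aemeasurable
  refine le_of_tendsto' (lintegral_tendsto_of_tendsto_of_monotone (fun n => ?_)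
    (ae_of_all _ fun x n k hnk => ?_) (ae_of_all _ fun x => ?_)) (fun n => main n a e hae)
  · exact (Real.measurable_exp.comp_aemeasurable
      ((hgm.restrict.sub_const _).abs.min aemeasurable_const)).ennreal_ofReal
  · dsimp only
    gcongr
  · obtain ⟨M, hM⟩ := exists_nat_ge (|g x - ⨍ y in Ioo a e, g y| / (3 / 10))
    refine tendsto_atTop_of_eventually_const (i₀ := M) fun n hn => ?_
    rw [min_eq_left]
    rw [div_le_iff₀ (by norm_num)] at hM
    refine hM.trans ?_
    gcongr

/-! ### The A_p^+ condition and its form with a gap. -/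

/-- The powers 1 and p - 1 of the length c - a combine to the power p, which is finite and non-zero.
-/
theorem apPlusConst_le_iff {p : ℝ} (hp : 1 < p) {w : ℝ → ℝ} {K : ℝ≥0∞} :
    apPlusConst p w ≤ K ↔ ∀ a b c : ℝ, a < b → b < c →
      (∫⁻ x in Ioo a b, ENNReal.ofReal (w x)) *
        (∫⁻ x in Ioo b c, ENNReal.ofReal (w x) ^ (-(1 / (p - 1)))) ^ (p - 1) ≤
      K * ENNReal.ofReal (c - a) ^ p := by
  unfold apPlusConst
  simp only [iSup_le_iff]
  refine forall_congr' fun a => forall_congr' fun b => forall_congr' fun c =>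
    forall_congr' fun hab => forall_congr' fun hbc => ?_
  have hD0 : ENNReal.ofReal (c - a) ≠ 0 := by simpa using hab.trans hbc
  have hDt : ENNReal.ofReal (c - a) ≠ ∞ := ENNReal.ofReal_ne_top
  generalize ENNReal.ofReal (c - a) = D at *
  generalize ∫⁻ x in Ioo a b, ENNReal.ofReal (w x) = X
  generalize ∫⁻ x in Ioo b c, ENNReal.ofReal (w x) ^ (-(1 / (p - 1))) = Y
  have e : X / D * (Y / D) ^ (p - 1) = X * Y ^ (p - 1) / D ^ p := by
    rw [ENNReal.div_rpow_of_nonneg _ _ (by linarith), div_eq_mul_inv, div_eq_mul_inv,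
      div_eq_mul_inv, show D ^ p = D * D ^ (p - 1) by
        rw [← add_sub_cancel 1 p, ENNReal.rpow_add _ _ hD0 hDt, ENNReal.rpow_one,
          add_sub_cancel_left],
      ENNReal.mul_inv (Or.inl hD0) (Or.inl hDt)]
    ring
  rw [e, ENNReal.div_le_iff (by simp [hD0, hDt]) (by simp [hD0, hDt])]

/-- Passing from a one-sided condition with a gap to the `A_p^+` condition. -/
theorem lintegral_mul_rpow_le_of_gap {p : ℝ} (hp : 1 < p) {v : ℝ → ℝ}
    (hv : LocallyIntegrable v volume) (hv0 : ∀ x, 0 ≤ v x) {τ : ℝ → ℝ≥0∞} {K : ℝ≥0∞} (hK : K ≠ ∞)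
    (hgap : ∀ x l : ℝ, 0 < l → (∫⁻ y in Ioo x (x + l), ENNReal.ofReal (v y)) *
      (∫⁻ y in Ioo (x + 2 * l) (x + 4 * l), τ y) ^ (p - 1) ≤ K * ENNReal.ofReal l ^ p)
    {a m c : ℝ} (ham : a < m) (hmc : m < c) :
    (∫⁻ y in Ioo a m, ENNReal.ofReal (v y)) * (∫⁻ y in Ioo m c, τ y) ^ (p - 1) ≤
      K * ENNReal.ofReal (c - a) ^ p := by
  have hp1 : 0 < p - 1 := sub_pos.2 hp
  have hac := ham.trans hmc
  have hca : 0 < c - a := sub_pos.2 hac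
  have hi := intervalIntegrable_of_locallyIntegrable hv
  -- some dyadic interval to the right of `x` has a large average
  have pick : ∀ μ : ℝ, 0 < μ → ENNReal.ofReal (μ * (c - a)) < ∫⁻ y in Ioo m c, τ y →
      ∀ x ∈ Ico a m, ∃ l, 0 < l ∧ x + 4 * l ≤ c ∧
        ENNReal.ofReal (μ * l) ≤ ∫⁻ y in Ioo (x + 2 * l) (x + 4 * l), τ y := by
    intro μ hμ hlt x hx
    by_contra! hcon
    have hL : 0 < c - x := by linarith [hx.2]
    refine absurd hlt (not_lt.2 ?_)
    -- With l = (c - x)/2^(n+2) these pieces are (x + 2l, x + 4l] and tile (x, c]. If none had mass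
    -- at least μl, the total would be too small.
    have hcov : Ioo m c ⊆ ⋃ n : ℕ, Ioc (x + (c - x) / 2 / 2 ^ n) (x + (c - x) / 2 ^ n) := by
      intro y hy
      have hyx : 0 < y - x := by linarith [hx.2, hy.1]
      obtain ⟨n, hn1, hn2⟩ := exists_nat_pow_near_of_lt_one (x := (y - x) / (c - x))
        (y := 1 / 2) (by positivity) (by rw [div_le_one hL]; linarith [hy.2]) (by norm_num)
        (by norm_num)
      rw [lt_div_iff₀ hL] at hn1
      rw [div_le_iff₀ hL] at hn2
      refine mem_iUnion.2 ⟨n, ?_, ?_⟩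
      · rw [one_div, inv_pow, pow_succ, mul_inv] at hn1
        rw [div_eq_mul_inv _ (2 ^ n), div_eq_mul_inv _ (2 : ℝ)]
        linarith
      · rw [one_div, inv_pow] at hn2
        rw [div_eq_mul_inv]
        linarith
    have hsum := hasSum_geometric_two' (c - x)
    calc ∫⁻ y in Ioo m c, τ y
        ≤ ∑' n : ℕ, ∫⁻ y in Ioc (x + (c - x) / 2 / 2 ^ n) (x + (c - x) / 2 ^ n), τ y :=
          (lintegral_mono_set hcov).trans (lintegral_iUnion_le _ _)
      _ ≤ ∑' n : ℕ, ENNReal.ofReal (μ * ((c - x) / 2 / 2 ^ n)) := by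
          refine ENNReal.tsum_le_tsum fun n => ?_
          have h := hcon ((c - x) / 2 / 2 ^ n / 2) (by positivity) (by
            have : (c - x) / 2 ^ n ≤ c - x := div_le_self hL.le (one_le_pow₀ (by norm_num))
            calc x + 4 * ((c - x) / 2 / 2 ^ n / 2) = x + (c - x) / 2 ^ n := by ring
              _ ≤ c := by linarith)
          rw [show x + 2 * ((c - x) / 2 / 2 ^ n / 2) = x + (c - x) / 2 / 2 ^ n by ring,
            show x + 4 * ((c - x) / 2 / 2 ^ n / 2) = x + (c - x) / 2 ^ n by ring] at h
          rw [← setLIntegral_congr Ioo_ae_eq_Ioc]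
          refine h.le.trans (ENNReal.ofReal_le_ofReal ?_)
          refine mul_le_mul_of_nonneg_left ?_ hμ.le
          exact half_le_self (by positivity)
      _ = ENNReal.ofReal (μ * (c - x)) := by
          rw [← (hsum.mul_left μ).tsum_eq, ENNReal.ofReal_tsum_of_nonneg (fun n => by positivity)
            (hsum.mul_left μ).summable]
      _ ≤ ENNReal.ofReal (μ * (c - a)) := by
          refine ENNReal.ofReal_le_ofReal ?_
          gcongr
          exact hx.1
  -- hence an estimate of the mass of `v` on `(a, m)`
  have mass : ∀ μ : ℝ, 0 < μ → ENNReal.ofReal (μ * (c - a)) < ∫⁻ y in Ioo m c, τ y →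
      ∫ y in a..m, v y ≤ K.toReal / μ ^ (p - 1) * (c - a) := by
    intro μ hμ hlt
    set L := K.toReal / μ ^ (p - 1) with hL
    have hL0 : 0 ≤ L := by positivity
    have hcont : Continuous fun y => (∫ z in a..min y m, v z) - L * (y - a) :=
      ((intervalIntegral.continuous_primitive hi a).comp
        (continuous_id.min continuous_const)).sub (by fun_prop)
    -- Continuous induction: if the last point `y` where the bound holds were below `m`, the
    -- interval chosen by `pick` at `y`, together with `hgap`, would carry the bound to y + l ≤ c.
    obtain ⟨y, ⟨hy, hyL⟩, hymax⟩ := (isCompact_Icc.inter_right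
      (isClosed_le hcont (continuous_const (y := (0 : ℝ))))).exists_isGreatest
      (⟨a, left_mem_Icc.2 hac.le, by simp [min_eq_left ham.le]⟩ :
        (Icc a c ∩ {y | (∫ z in a..min y m, v z) - L * (y - a) ≤ 0}).Nonempty)
    have hyL' : (∫ z in a..min y m, v z) ≤ L * (y - a) := sub_nonpos.1 hyL
    rcases le_or_gt m y with hmy | hym
    · rw [min_eq_right hmy] at hyL'
      refine hyL'.trans ?_
      gcongr
      exact hy.2
    · exfalso
      obtain ⟨l, hl, hlc, hτ⟩ := pick μ hμ hlt y ⟨hy.1, hym⟩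
      have hvl : ∫ z in y..(y + l), v z ≤ L * l := by
        have h1 := hgap y l hl
        rw [lintegral_Ioo_ofReal hv hv0 (by linarith)] at h1
        have h0 : 0 ≤ ∫ z in y..(y + l), v z :=
          intervalIntegral.integral_nonneg (by linarith) fun x _ => hv0 x
        have h2 : ENNReal.ofReal ((∫ z in y..(y + l), v z) * (μ * l) ^ (p - 1)) ≤
            ENNReal.ofReal (K.toReal * l ^ p) := by
          rw [ENNReal.ofReal_mul h0, ENNReal.ofReal_mul ENNReal.toReal_nonneg,
            ENNReal.ofReal_toReal hK, ← ENNReal.ofReal_rpow_of_pos hl,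
            ← ENNReal.ofReal_rpow_of_pos (by positivity)]
          refine le_trans ?_ h1
          gcongr
        rw [ENNReal.ofReal_le_ofReal_iff (by positivity), Real.mul_rpow hμ.le hl.le,
          show l ^ p = l * l ^ (p - 1) by rw [← Real.rpow_one_add' hl.le (by linarith)]; ring_nf]
          at h2
        have hlp : 0 < l ^ (p - 1) := by positivity
        have hμp : 0 < μ ^ (p - 1) := by positivity
        rw [hL, div_mul_eq_mul_div, le_div_iff₀ hμp]
        refine le_of_mul_le_mul_right (le_of_eq_of_le ?_ (h2.trans_eq ?_)) hlp <;> ring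
      have hmem : y + l ∈ Icc a c ∩ {y | (∫ z in a..min y m, v z) - L * (y - a) ≤ 0} := by
        refine ⟨⟨by linarith [hy.1], by linarith⟩, ?_⟩
        change (∫ z in a..min (y + l) m, v z) - L * (y + l - a) ≤ 0
        rw [min_eq_left hym.le] at hyL'
        have hmono : ∫ z in y..min (y + l) m, v z ≤ ∫ z in y..(y + l), v z :=
          intervalIntegral.integral_mono_interval le_rfl (le_min (by linarith) hym.le)
            (min_le_left _ _) (ae_of_all _ hv0) (hi _ _)
        rw [← intervalIntegral.integral_add_adjacent_intervals (hi a y) (hi y _)]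
        linarith
      linarith [hymax hmem]
  -- conclusion
  have hVr := lintegral_Ioo_ofReal hv hv0 ham.le
  set V := ∫⁻ y in Ioo a m, ENNReal.ofReal (v y) with hV
  rcases eq_or_ne V 0 with hV0 | hV0
  · rw [hV0, zero_mul]
    exact zero_le
  have hVt : V ≠ ∞ := by rw [hVr]; exact ENNReal.ofReal_ne_top
  rw [mul_comm, ← ENNReal.le_div_iff_mul_le (Or.inl hV0) (Or.inl hVt),
    ← ENNReal.le_rpow_inv_iff hp1]
  -- Approximating the integral of `τ` from below by finite `n` also covers the case where it is
  -- infinite; μ is then n/(c - a).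
  refine ENNReal.le_of_forall_nnreal_lt fun n hn => ?_
  rw [ENNReal.le_rpow_inv_iff hp1, ENNReal.le_div_iff_mul_le (Or.inl hV0) (Or.inl hVt)]
  rcases eq_or_ne n 0 with rfl | hn0
  · rw [ENNReal.coe_zero, ENNReal.zero_rpow_of_pos hp1, zero_mul]
    exact zero_le
  have hnpos : (0 : ℝ) < n := NNReal.coe_pos.2 (pos_iff_ne_zero.2 hn0)
  have h1 := mass (n / (c - a)) (by positivity) (by
    rw [div_mul_cancel₀ _ hca.ne', ENNReal.ofReal_coe_nnreal]
    exact hn)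
  rw [Real.div_rpow hnpos.le hca.le, ← div_mul, div_mul_eq_mul_div, div_mul_eq_mul_div,
    le_div_iff₀ (by positivity), mul_assoc,
    show (c - a) ^ (p - 1) * (c - a) = (c - a) ^ p by
      rw [← Real.rpow_add_one hca.ne']; ring_nf] at h1
  rw [hVr, ← ENNReal.ofReal_coe_nnreal, ENNReal.ofReal_rpow_of_pos hnpos,
    ← ENNReal.ofReal_mul (by positivity), ENNReal.ofReal_rpow_of_pos hca,
    ← ENNReal.ofReal_toReal hK, ← ENNReal.ofReal_mul ENNReal.toReal_nonneg]
  refine ENNReal.ofReal_le_ofReal ?_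
  linarith

/-! ### Hölder against the exponential. -/

/-- Perturbing a function satisfying a reverse Hölder inequality by the exponential of a function
of small `BMO` norm. -/
theorem lintegral_exp_mul_le {f : ℝ → ℝ≥0∞} {b : ℝ → ℝ} (hb : LocallyIntegrable b volume)
    {u δ l x₀ x₁ : ℝ} {S : Set ℝ} {Y : ℝ≥0∞} (hf : AEMeasurable f (volume.restrict S)) (hδ : 0 < δ)
    (hl : 0 < l) (hx : x₁ - x₀ = 4 * l) (hS : S ⊆ Ioo x₀ x₁)
    (hR : ∫⁻ x in S, f x ^ (1 + δ) ≤ Y ^ (1 + δ) * ENNReal.ofReal l)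
    (hB : bmoNorm (fun x => u * (1 + 1 / δ) * b x) ≤ ENNReal.ofReal (1 / 20)) :
    ∫⁻ x in S, ENNReal.ofReal (Real.exp (u * b x)) * f x ≤
      ENNReal.ofReal (Real.exp (u * ⨍ y in Ioo x₀ x₁, b y)) *
        (48 * (Y * ENNReal.ofReal l)) := by
  set A := ⨍ y in Ioo x₀ x₁, b y with hA
  set r := 1 + δ with hr
  set r' := 1 + 1 / δ with hr'
  have hr'0 : 0 < r' := by positivity
  have hr'1 : 1 ≤ r' := by rw [hr']; simp [hδ.le]
  have hconj : r.HolderConjugate r' := by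
    rw [Real.holderConjugate_iff]
    refine ⟨by linarith, ?_⟩
    rw [hr, hr']
    field_simp
    ring
  have hbm := hb.aestronglyMeasurable.aemeasurable
  set G : ℝ → ℝ≥0∞ := fun x => ENNReal.ofReal (Real.exp (u * (b x - A))) with hG
  have hGm : AEMeasurable G (volume.restrict S) :=
    (Real.measurable_exp.comp_aemeasurable
      ((hbm.restrict.sub_const A).const_mul u)).ennreal_ofReal
  -- 48 is the John–Nirenberg constant 12 times the length ratio 4.
  have hJN : ∫⁻ x in S, G x ^ r' ≤ 48 * ENNReal.ofReal l := by
    have h := john_nirenberg (g := fun x => u * r' * b x) (hb.smul (u * r')) hB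
      (show x₀ < x₁ by linarith)
    rw [hx, ENNReal.ofReal_mul (by norm_num), ← mul_assoc,
      show (12 : ℝ≥0∞) * ENNReal.ofReal 4 = 48 by
        rw [show ENNReal.ofReal 4 = 4 by simp]; norm_num] at h
    refine (lintegral_mono_set hS).trans (le_trans (lintegral_mono fun x => ?_) h)
    have hav : ⨍ y in Ioo x₀ x₁, u * r' * b y = u * r' * A := by
      rw [hA, setAverage_eq, setAverage_eq, integral_const_mul, smul_eq_mul, smul_eq_mul]
      ring
    rw [hav, hG]
    dsimp only
    rw [ENNReal.ofReal_rpow_of_pos (Real.exp_pos _), ← Real.exp_mul]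
    refine ENNReal.ofReal_le_ofReal (Real.exp_le_exp.2 (le_trans (le_of_eq ?_) (le_abs_self _)))
    ring
  have hH := ENNReal.lintegral_mul_le_Lp_mul_Lq (volume.restrict S) hconj hf hGm
  have hD0 : ENNReal.ofReal l ≠ 0 := by simpa using hl
  have hDt : ENNReal.ofReal l ≠ ∞ := ENNReal.ofReal_ne_top
  calc ∫⁻ x in S, ENNReal.ofReal (Real.exp (u * b x)) * f x
      = ∫⁻ x in S, ENNReal.ofReal (Real.exp (u * A)) * (f * G) x := by
        refine lintegral_congr fun x => ?_
        rw [Pi.mul_apply, hG, mul_comm (f x), ← mul_assoc,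
          ← ENNReal.ofReal_mul (Real.exp_pos _).le, ← Real.exp_add]
        congr 3
        ring
    _ = ENNReal.ofReal (Real.exp (u * A)) * ∫⁻ x in S, (f * G) x :=
        lintegral_const_mul' _ _ ENNReal.ofReal_ne_top
    _ ≤ _ := by
        gcongr
        refine hH.trans ?_
        calc (∫⁻ x in S, f x ^ r) ^ (1 / r) * (∫⁻ x in S, G x ^ r') ^ (1 / r')
            ≤ (Y ^ r * ENNReal.ofReal l) ^ (1 / r) * (48 * ENNReal.ofReal l) ^ (1 / r') := by
              have := hconj.pos
              gcongr
          _ = 48 ^ (1 / r') * (Y * ENNReal.ofReal l) := by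
              have hr0 := hconj.pos
              rw [ENNReal.mul_rpow_of_nonneg _ _ (by positivity),
                ENNReal.mul_rpow_of_nonneg _ _ (by positivity), ← ENNReal.rpow_mul,
                mul_one_div_cancel hr0.ne', ENNReal.rpow_one]
              have : ENNReal.ofReal l ^ (1 / r) * ENNReal.ofReal l ^ (1 / r') =
                  ENNReal.ofReal l := by
                rw [← ENNReal.rpow_add _ _ hD0 hDt, one_div, one_div, hconj.inv_add_inv_eq_one,
                  ENNReal.rpow_one]
              calc _ = 48 ^ (1 / r') * (Y * (ENNReal.ofReal l ^ (1 / r) *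
                    ENNReal.ofReal l ^ (1 / r'))) := by ring
                _ = _ := by rw [this]
          _ ≤ _ := by
              gcongr
              calc (48 : ℝ≥0∞) ^ (1 / r') ≤ 48 ^ (1 : ℝ) := by
                    refine ENNReal.rpow_le_rpow_of_exponent_le (by norm_num) ?_
                    rw [div_le_one hr'0]
                    exact hr'1
                _ = 48 := ENNReal.rpow_one _

/-! ### Level sets of A_p^+ weights and the choice of exponent. -/

/-- If `{f ≤ κ}` takes at most half of one of the halves of an interval, then `{f > κ}` fills a
quarter of the interval. -/
theorem quarter_le_volume_superlevel {f : ℝ → ℝ} {κ α β x y : ℝ} (hαβ : α < β) (hx : α ≤ x)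
    (hy : y ≤ β) (hxy : y - x = (β - α) / 2)
    (h : volume (Ioo x y ∩ {z | f z ≤ κ}) ≤ ENNReal.ofReal ((β - α) / 4)) :
    ENNReal.ofReal ((β - α) / 4) ≤ volume (Ioo α β ∩ {z | κ < f z}) := by
  have hL : 0 < β - α := sub_pos.2 hαβ
  have h1 : ENNReal.ofReal ((β - α) / 4) + ENNReal.ofReal ((β - α) / 4) ≤
      ENNReal.ofReal ((β - α) / 4) + volume (Ioo α β ∩ {z | κ < f z}) := by
    calc ENNReal.ofReal ((β - α) / 4) + ENNReal.ofReal ((β - α) / 4)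
        = volume (Ioo x y) := by
          rw [← ENNReal.ofReal_add (by positivity) (by positivity), Real.volume_Ioo, hxy]
          congr 1
          ring
      _ ≤ volume ((Ioo x y ∩ {z | f z ≤ κ}) ∪ (Ioo α β ∩ {z | κ < f z})) := by
          refine measure_mono fun z hz => ?_
          rcases le_or_gt (f z) κ with hk | hk
          · exact Or.inl ⟨hz, hk⟩
          · exact Or.inr ⟨Ioo_subset_Ioo hx hy hz, hk⟩
      _ ≤ _ := (measure_union_le _ _).trans (by gcongr)
  exact (ENNReal.add_le_add_iff_left ENNReal.ofReal_ne_top).1 h1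

/-- Chebyshev's inequality for the dual weight, which is at least κ^(-1/(p-1)) where w ≤ κ. -/
theorem volume_sublevel_rpow_le {p : ℝ} (hp : 1 < p) {w : ℝ → ℝ} (hw : AEMeasurable w volume)
    {κ : ℝ} (hκ : 0 < κ) (S : Set ℝ) :
    volume (S ∩ {x | w x ≤ κ}) ^ (p - 1) ≤
      ENNReal.ofReal κ * (∫⁻ x in S, ENNReal.ofReal (w x) ^ (-(1 / (p - 1)))) ^ (p - 1) := by
  have hp1 : 0 < p - 1 := sub_pos.2 hp
  have hk0 : ENNReal.ofReal κ ≠ 0 := by simpa using hκ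
  have hkt : ENNReal.ofReal κ ≠ ∞ := ENNReal.ofReal_ne_top
  set k := 1 / (p - 1) with hk
  have hkpos : 0 < k := by positivity
  have h1 : ENNReal.ofReal κ ^ (-k) * volume (S ∩ {x | w x ≤ κ}) ≤
      ∫⁻ x in S, ENNReal.ofReal (w x) ^ (-k) := by
    refine le_trans ?_ (mul_meas_ge_le_lintegral₀ (hw.ennreal_ofReal.restrict.pow_const (-k))
      (ENNReal.ofReal κ ^ (-k)))
    refine mul_le_mul_right ?_ _
    rw [inter_comm]
    refine (Measure.le_restrict_apply _ _).trans (measure_mono fun x hx => ?_)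
    have hx : w x ≤ κ := hx
    change ENNReal.ofReal κ ^ (-k) ≤ ENNReal.ofReal (w x) ^ (-k)
    rw [ENNReal.rpow_neg, ENNReal.rpow_neg]
    gcongr
  have h2 := ENNReal.rpow_le_rpow h1 hp1.le
  rw [ENNReal.mul_rpow_of_nonneg _ _ hp1.le, ← ENNReal.rpow_mul,
    show -k * (p - 1) = -1 by rw [hk]; field_simp, ENNReal.rpow_neg_one] at h2
  calc volume (S ∩ {x | w x ≤ κ}) ^ (p - 1)
      = ENNReal.ofReal κ * ((ENNReal.ofReal κ)⁻¹ * volume (S ∩ {x | w x ≤ κ}) ^ (p - 1)) := by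
        rw [← mul_assoc, ENNReal.mul_inv_cancel hk0 hkt, one_mul]
    _ ≤ _ := by gcongr

theorem ofReal_rpow_split {p L : ℝ} (hL : 0 < L) :
    ENNReal.ofReal L ^ p = ENNReal.ofReal (L * L ^ (p - 1)) := by
  rw [ENNReal.ofReal_rpow_of_pos hL]
  congr 1
  rw [mul_comm, ← Real.rpow_add_one hL.ne', sub_add_cancel]

/-- An `A_p^+` weight satisfies the hypothesis of `reverse_holder`. -/
theorem superlevel_of_apPlus {p : ℝ} (hp : 1 < p) {w : ℝ → ℝ} (hw : IsWeight w) {A γ : ℝ}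
    (hA0 : 0 ≤ A) (hA : apPlusConst p w ≤ ENNReal.ofReal A) (hγ : 0 < γ)
    (hγA : 2 * A * γ * 4 ^ (p - 1) ≤ 1) {α β l : ℝ} (hαβ : α < β) (hl : 0 < l)
    (h : ∀ x ∈ Ioo α β, l * (x - α) ≤ ∫ y in α..x, w y) :
    ENNReal.ofReal ((β - α) / 4) ≤ volume (Ioo α β ∩ {x | γ * l < w x}) := by
  have hp1 : 0 < p - 1 := sub_pos.2 hp
  have hL : 0 < β - α := sub_pos.2 hαβ
  set m := (α + β) / 2 with hm
  have hαm : α < m := by linarith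
  have hmβ : m < β := by linarith
  -- The left half has mass at least l(β - α)/2, so A_p^+ bounds the dual mass on the right half,
  -- and Chebyshev then limits where `w` is small there.
  refine quarter_le_volume_superlevel (x := m) (y := β) hαβ hαm.le le_rfl (by rw [hm]; ring) ?_
  have hv : volume (Ioo m β ∩ {z | w z ≤ γ * l}) ≠ ∞ :=
    measure_ne_top_of_subset inter_subset_left (by simp)
  have h1 := volume_sublevel_rpow_le hp hw.2.aestronglyMeasurable.aemeasurable
    (mul_pos hγ hl) (Ioo m β)
  have h2 := (apPlusConst_le_iff hp).1 hA α m β hαm hmβ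
  have h3 : ENNReal.ofReal (l * (β - α) / 2) ≤ ∫⁻ x in Ioo α m, ENNReal.ofReal (w x) := by
    rw [lintegral_Ioo_ofReal hw.2 hw.1 hαm.le]
    refine ENNReal.ofReal_le_ofReal (le_of_eq_of_le ?_ (h m ⟨hαm, hmβ⟩))
    rw [hm]
    ring
  set v := volume (Ioo m β ∩ {z | w z ≤ γ * l})
  have h4 : ENNReal.ofReal (l * (β - α) / 2) * v ^ (p - 1) ≤
      ENNReal.ofReal (γ * l) * (ENNReal.ofReal A * ENNReal.ofReal (β - α) ^ p) := by
    refine (mul_le_mul h3 h1 zero_le zero_le).trans ?_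
    rw [mul_left_comm]
    gcongr
  rw [← ENNReal.ofReal_toReal hv]
  rw [← ENNReal.ofReal_toReal hv, ENNReal.ofReal_rpow_of_nonneg ENNReal.toReal_nonneg hp1.le,
    ofReal_rpow_split hL, ← ENNReal.ofReal_mul (by positivity), ← ENNReal.ofReal_mul hA0,
    ← ENNReal.ofReal_mul (by positivity), ENNReal.ofReal_le_ofReal_iff (by positivity)] at h4
  refine ENNReal.ofReal_le_ofReal ?_
  rw [← Real.rpow_le_rpow_iff ENNReal.toReal_nonneg (by positivity) hp1,
    Real.div_rpow hL.le (by norm_num), le_div_iff₀ (by positivity)]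
  have hLp : 0 < (β - α) ^ (p - 1) := by positivity
  have h5 : v.toReal ^ (p - 1) ≤ 2 * A * γ * (β - α) ^ (p - 1) := by
    refine le_of_mul_le_mul_left ?_ (show 0 < l * (β - α) / 2 by positivity)
    refine h4.trans_eq ?_
    ring
  calc v.toReal ^ (p - 1) * 4 ^ (p - 1) ≤ 2 * A * γ * (β - α) ^ (p - 1) * 4 ^ (p - 1) := by gcongr
    _ = (2 * A * γ * 4 ^ (p - 1)) * (β - α) ^ (p - 1) := by ring
    _ ≤ 1 * (β - α) ^ (p - 1) := by gcongr
    _ = _ := one_mul _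

/-- The dual of an `A_p^+` weight satisfies the hypothesis of `reverse_holder_reflected`. -/
theorem superlevel_dual_of_apPlus {p : ℝ} (hp : 1 < p) {w : ℝ → ℝ} (hw : IsWeight w) {A γ : ℝ}
    (hA0 : 0 ≤ A) (hA : apPlusConst p w ≤ ENNReal.ofReal A) (hγ : 0 < γ)
    (hγA : 4 * A * (2 * γ) ^ (p - 1) ≤ 1) {s : ℝ → ℝ} (hs : LocallyIntegrable s volume)
    (hs0 : ∀ x, 0 ≤ s x) {α β l : ℝ} (hαβ : α < β) (hl : 0 < l)
    (hsw : ∀ᵐ x, x ∈ Ioo α β → ENNReal.ofReal (s x) = ENNReal.ofReal (w x) ^ (-(1 / (p - 1))))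
    (h : ∀ x ∈ Ioo α β, l * (β - x) ≤ ∫ y in x..β, s y) :
    ENNReal.ofReal ((β - α) / 4) ≤ volume (Ioo α β ∩ {x | γ * l < s x}) := by
  have hp1 : 0 < p - 1 := sub_pos.2 hp
  have hL : 0 < β - α := sub_pos.2 hαβ
  set m := (α + β) / 2 with hm
  have hαm : α < m := by linarith
  have hmβ : m < β := by linarith
  refine quarter_le_volume_superlevel (x := α) (y := m) hαβ le_rfl hmβ.le (by rw [hm]; ring) ?_
  have hv : volume (Ioo α m ∩ {z | s z ≤ γ * l}) ≠ ∞ :=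
    measure_ne_top_of_subset inter_subset_left (by simp)
  set v := volume (Ioo α m ∩ {z | s z ≤ γ * l}) with hvdef
  have h2 := (apPlusConst_le_iff hp).1 hA α m β hαm hmβ
  have h3 : ENNReal.ofReal (l * (β - α) / 2) ≤
      ∫⁻ x in Ioo m β, ENNReal.ofReal (w x) ^ (-(1 / (p - 1))) := by
    have e : ∫⁻ x in Ioo m β, ENNReal.ofReal (w x) ^ (-(1 / (p - 1))) =
        ∫⁻ x in Ioo m β, ENNReal.ofReal (s x) := by
      refine setLIntegral_congr_fun_ae measurableSet_Ioo ?_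
      filter_upwards [hsw] with x hx hxm
      exact (hx (Ioo_subset_Ioo_left hαm.le hxm)).symm
    rw [e, lintegral_Ioo_ofReal hs hs0 hmβ.le]
    refine ENNReal.ofReal_le_ofReal (le_of_eq_of_le ?_ (h m ⟨hαm, hmβ⟩))
    rw [hm]
    ring
  -- Chebyshev for `w` itself: s ≤ γl means w ≥ (γl)^(-(p-1)).
  have h1 : v ≤ ENNReal.ofReal ((γ * l) ^ (p - 1)) * ∫⁻ x in Ioo α m, ENNReal.ofReal (w x) := by
    set κ := ENNReal.ofReal ((γ * l) ^ (p - 1)) with hκ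
    have hκ0 : κ ≠ 0 := by
      rw [hκ]; simp only [ne_eq, ENNReal.ofReal_eq_zero, not_le]; positivity
    have hκt : κ ≠ ∞ := ENNReal.ofReal_ne_top
    have hwm := hw.2.aestronglyMeasurable.aemeasurable.ennreal_ofReal
    have h5 : κ⁻¹ * v ≤ ∫⁻ x in Ioo α m, ENNReal.ofReal (w x) := by
      refine le_trans ?_ (mul_meas_ge_le_lintegral₀ hwm.restrict κ⁻¹)
      gcongr
      rw [Measure.restrict_apply' measurableSet_Ioo, hvdef]
      refine measure_mono_ae ?_
      filter_upwards [hsw] with x hx hxv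
      refine ⟨?_, hxv.1⟩
      have hsx : s x ≤ γ * l := hxv.2
      have hx' := hx (Ioo_subset_Ioo_right hmβ.le hxv.1)
      change κ⁻¹ ≤ ENNReal.ofReal (w x)
      rw [ENNReal.inv_le_iff_inv_le]
      have h6 : ENNReal.ofReal (s x) ^ (p - 1) = (ENNReal.ofReal (w x))⁻¹ := by
        rw [hx', ← ENNReal.rpow_mul, show -(1 / (p - 1)) * (p - 1) = -1 by field_simp,
          ENNReal.rpow_neg_one]
      rw [← h6, hκ, ← ENNReal.ofReal_rpow_of_pos (by positivity)]
      gcongr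
    calc v = κ * (κ⁻¹ * v) := by rw [← mul_assoc, ENNReal.mul_inv_cancel hκ0 hκt, one_mul]
      _ ≤ _ := by gcongr
  have h4 : v * ENNReal.ofReal (l * (β - α) / 2) ^ (p - 1) ≤
      ENNReal.ofReal ((γ * l) ^ (p - 1)) * (ENNReal.ofReal A * ENNReal.ofReal (β - α) ^ p) := by
    refine (mul_le_mul h1 (ENNReal.rpow_le_rpow h3 hp1.le) zero_le zero_le).trans ?_
    rw [mul_assoc]
    gcongr
  rw [← ENNReal.ofReal_toReal hv]
  rw [← ENNReal.ofReal_toReal hv, ENNReal.ofReal_rpow_of_pos (by positivity),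
    ofReal_rpow_split hL, ← ENNReal.ofReal_mul ENNReal.toReal_nonneg, ← ENNReal.ofReal_mul hA0,
    ← ENNReal.ofReal_mul (by positivity), ENNReal.ofReal_le_ofReal_iff (by positivity),
    Real.div_rpow (by positivity) (by norm_num), Real.mul_rpow hl.le hL.le,
    Real.mul_rpow hγ.le hl.le] at h4
  rw [Real.mul_rpow (by norm_num) hγ.le] at hγA
  refine ENNReal.ofReal_le_ofReal ?_
  have hq : 0 < l ^ (p - 1) * (β - α) ^ (p - 1) := by positivity
  have h2p : (0 : ℝ) < 2 ^ (p - 1) := by positivity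
  rw [mul_div_assoc', div_le_iff₀ h2p] at h4
  have h5 : v.toReal ≤ A * (2 ^ (p - 1) * γ ^ (p - 1)) * (β - α) := by
    refine le_of_mul_le_mul_right (h4.trans_eq ?_) hq
    ring
  nlinarith

/-- The `A_p^+` constant of a non-trivial weight is bounded below. -/
theorem le_of_apPlusConst_le {p : ℝ} (hp : 1 < p) {w : ℝ → ℝ} (hw : IsWeight w) {A : ℝ}
    (hA0 : 0 ≤ A) (hA : apPlusConst p w ≤ ENNReal.ofReal A) (hne : ¬ w =ᵐ[volume] 0) :
    (4 : ℝ) ^ (-(p + 1)) ≤ A := by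
  have hp1 : 0 < p - 1 := sub_pos.2 hp
  -- At a Lebesgue point with w x > 0, on a small scale the left average is at least w x / 2 and the
  -- right average at most 2 w x; hence w ≤ 4 w x on half of the right interval.
  obtain ⟨x, hxd, hx0⟩ : ∃ x, (∀ c, HasDerivAt (fun x => ∫ t in c..x, w t) (w x) x) ∧ w x ≠ 0 := by
    by_contra! hcon
    refine hne ?_
    filter_upwards [_root_.LocallyIntegrable.ae_hasDerivAt_integral hw.2] with x hx
    exact hcon x hx
  have hx : 0 < w x := lt_of_le_of_ne (hw.1 x) hx0.symm
  have hev := (hasDerivAt_iff_tendsto_slope.1 (hxd x)).eventually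
    (Ioo_mem_nhds (show w x / 2 < w x by linarith) (show w x < 2 * w x by linarith))
  obtain ⟨r, hr, hball⟩ := Metric.mem_nhdsWithin_iff.1 hev
  set h := r / 2 with hh
  have hh0 : 0 < h := by positivity
  have hR := hball (a := x + h) ⟨by simp [abs_of_pos hh0]; linarith, by simp [hh0.ne']⟩
  have hLft := hball (a := x - h) ⟨by simp [abs_of_pos hh0]; linarith,
    by simp [hh0.ne']⟩
  simp only [slope_def_field, mem_ofPred_eq, intervalIntegral.integral_same, sub_zero,
    add_sub_cancel_left, sub_sub_cancel_left] at hR hLft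
  have hright : ∫ t in x..(x + h), w t ≤ 2 * w x * h := ((div_lt_iff₀ hh0).1 hR.2).le
  have hleft : w x / 2 * h ≤ ∫ t in (x - h)..x, w t := by
    rw [intervalIntegral.integral_symm, neg_div_neg_eq] at hLft
    exact ((lt_div_iff₀ hh0).1 hLft.1).le
  have h1 := volume_sublevel_rpow_le hp hw.2.aestronglyMeasurable.aemeasurable
    (show 0 < 4 * w x by positivity) (Ioo x (x + h))
  have h2 := (apPlusConst_le_iff hp).1 hA (x - h) x (x + h) (by linarith) (by linarith)
  rw [lintegral_Ioo_ofReal hw.2 hw.1 (by linarith), show x + h - (x - h) = 2 * h by ring] at h2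
  have hhalf : ENNReal.ofReal (h / 2) ≤ volume (Ioo x (x + h) ∩ {y | w y ≤ 4 * w x}) := by
    have hM : ENNReal.ofReal (4 * w x) * volume (Ioo x (x + h) ∩ {y | 4 * w x < w y}) ≤
        ENNReal.ofReal (4 * w x) * ENNReal.ofReal (h / 2) := by
      calc _ ≤ ENNReal.ofReal (4 * w x) * volume.restrict (Ioo x (x + h))
              {y | ENNReal.ofReal (4 * w x) ≤ ENNReal.ofReal (w y)} := by
            refine mul_le_mul_right ?_ _
            rw [inter_comm]
            refine (Measure.le_restrict_apply _ _).trans (measure_mono fun y hy => ?_)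
            exact ENNReal.ofReal_le_ofReal (le_of_lt hy)
        _ ≤ ∫⁻ y in Ioo x (x + h), ENNReal.ofReal (w y) :=
            mul_meas_ge_le_lintegral₀ hw.2.aestronglyMeasurable.aemeasurable.ennreal_ofReal.restrict
              _
        _ = ENNReal.ofReal (∫ y in x..(x + h), w y) :=
            lintegral_Ioo_ofReal hw.2 hw.1 (by linarith)
        _ ≤ _ := by
            rw [← ENNReal.ofReal_mul (by positivity)]
            exact ENNReal.ofReal_le_ofReal (by linarith)
    have hM' := (ENNReal.mul_le_mul_iff_right (by simpa using hx) ENNReal.ofReal_ne_top).1 hM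
    have hsum : ENNReal.ofReal (h / 2) + ENNReal.ofReal (h / 2) ≤
        volume (Ioo x (x + h) ∩ {y | w y ≤ 4 * w x}) + ENNReal.ofReal (h / 2) := by
      calc _ = volume (Ioo x (x + h)) := by
            rw [← ENNReal.ofReal_add (by positivity) (by positivity), Real.volume_Ioo]
            congr 1
            ring
        _ ≤ volume ((Ioo x (x + h) ∩ {y | w y ≤ 4 * w x}) ∪
              (Ioo x (x + h) ∩ {y | 4 * w x < w y})) := by
            refine measure_mono fun z hz => ?_
            rcases le_or_gt (w z) (4 * w x) with hk | hk
            · exact Or.inl ⟨hz, hk⟩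
            · exact Or.inr ⟨hz, hk⟩
        _ ≤ _ := (measure_union_le _ _).trans (by gcongr)
    exact (ENNReal.add_le_add_iff_right ENNReal.ofReal_ne_top).1 hsum
  have h3 : ENNReal.ofReal (w x / 2 * h) * ENNReal.ofReal (h / 2) ^ (p - 1) ≤
      ENNReal.ofReal (4 * w x) * (ENNReal.ofReal A * ENNReal.ofReal (2 * h) ^ p) := by
    calc _ ≤ ENNReal.ofReal (∫ t in (x - h)..x, w t) * (ENNReal.ofReal (4 * w x) *
          (∫⁻ y in Ioo x (x + h), ENNReal.ofReal (w y) ^ (-(1 / (p - 1)))) ^ (p - 1)) := by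
          gcongr
          exact (ENNReal.rpow_le_rpow hhalf hp1.le).trans h1
      _ ≤ _ := by
          rw [mul_left_comm]
          gcongr
  rw [ENNReal.ofReal_rpow_of_pos (by positivity), ENNReal.ofReal_rpow_of_pos (by positivity),
    ← ENNReal.ofReal_mul (by positivity), ← ENNReal.ofReal_mul hA0,
    ← ENNReal.ofReal_mul (by positivity), ENNReal.ofReal_le_ofReal_iff (by positivity)] at h3
  have e1 : w x / 2 * h * (h / 2) ^ (p - 1) = 4 * w x * (2 * h) ^ p * 4 ^ (-(p + 1)) := by
    have e2 : (h / 2) ^ (p - 1) = (h / 2) ^ p / (h / 2) := Real.rpow_sub_one (by positivity) p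
    have e3 : (2 * h) ^ p = (h / 2) ^ p * 4 ^ p := by
      rw [← Real.mul_rpow (by positivity) (by norm_num)]
      congr 1
      ring
    have e4 : (4 : ℝ) ^ (-(p + 1)) = (4 ^ p)⁻¹ / 4 := by
      rw [Real.rpow_neg (by norm_num), Real.rpow_add_one (by norm_num), mul_inv, div_eq_mul_inv]
    rw [e2, e3, e4]
    field_simp
  rw [e1] at h3
  refine le_of_mul_le_mul_left (h3.trans_eq ?_) (show 0 < 4 * w x * (2 * h) ^ p by positivity)
  ring

/-- The choice of the exponent in the reverse Hölder inequalities. -/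
theorem exists_exponent {p : ℝ} (hp : 1 < p) : ∃ c : ℝ, 0 < c ∧ ∀ A : ℝ, 4 ^ (-(p + 1)) ≤ A →
    c * A ^ (-(max 1 (1 / (p - 1)))) ≤ 1 ∧
    2 * A * (c * A ^ (-(max 1 (1 / (p - 1))))) * 4 ^ (p - 1) ≤ 1 ∧
    4 * A * (2 * (c * A ^ (-(max 1 (1 / (p - 1)))))) ^ (p - 1) ≤ 1 := by
  have hp1 : 0 < p - 1 := sub_pos.2 hp
  set q := max 1 (1 / (p - 1)) with hq
  set a : ℝ := 4 ^ (-(p + 1)) with ha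
  have ha0 : 0 < a := by positivity
  have ha1 : a ≤ 1 := Real.rpow_le_one_of_one_le_of_nonpos (by norm_num) (by linarith)
  have hq1 : 1 ≤ q := le_max_left _ _
  have hqp : 1 / (p - 1) ≤ q := le_max_right _ _
  -- One factor for each of the last two conditions; both are at most 1, so their product serves
  -- both.
  set d : ℝ := 4 ^ (-(p - 1)) * 4 ^ (-(1 / (p - 1))) / 2 with hd
  have hd0 : 0 < d := by positivity
  have b1 : (4 : ℝ) ^ (-(p - 1)) ≤ 1 :=
    Real.rpow_le_one_of_one_le_of_nonpos (by norm_num) (by linarith)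
  have b2 : (4 : ℝ) ^ (-(1 / (p - 1))) ≤ 1 :=
    Real.rpow_le_one_of_one_le_of_nonpos (by norm_num) (neg_nonpos.2 (by positivity))
  have b1' : (0 : ℝ) < 4 ^ (-(p - 1)) := by positivity
  have b2' : (0 : ℝ) < 4 ^ (-(1 / (p - 1))) := by positivity
  refine ⟨d * a ^ q, by positivity, fun A hA => ?_⟩
  have hA0 : 0 < A := ha0.trans_le hA
  -- The lower bound A ≥ a lets A^(-q) replace any A^(-s) with 0 ≤ s ≤ q; the factor a^q pays for
  -- it. It is used with s = 0, 1 and 1/(p-1).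
  have key : ∀ s, 0 ≤ s → s ≤ q → d * a ^ q * A ^ (-q) ≤ d * A ^ (-s) := by
    intro s hs0 hs
    rw [mul_assoc]
    gcongr
    calc a ^ q * A ^ (-q) = a ^ s * a ^ (q - s) * (A ^ (-s) * A ^ (-(q - s))) := by
          rw [← Real.rpow_add ha0, ← Real.rpow_add hA0]
          congr 2 <;> ring
      _ ≤ 1 * a ^ (q - s) * (A ^ (-s) * a ^ (-(q - s))) := by
          gcongr ?_ * _ * (_ * ?_)
          · exact Real.rpow_le_one ha0.le ha1 hs0
          · exact Real.rpow_le_rpow_of_nonpos ha0 hA (by linarith)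
      _ = A ^ (-s) := by
          rw [Real.rpow_neg ha0.le]
          field_simp
  have hg0 : 0 < d * a ^ q * A ^ (-q) := by positivity
  refine ⟨?_, ?_, ?_⟩
  · have := key 0 le_rfl (by linarith)
    rw [neg_zero, Real.rpow_zero, mul_one] at this
    refine this.trans ?_
    rw [hd]
    nlinarith
  · have := key 1 zero_le_one hq1
    calc 2 * A * (d * a ^ q * A ^ (-q)) * 4 ^ (p - 1) ≤ 2 * A * (d * A ^ (-1 : ℝ)) * 4 ^ (p - 1) := by
          gcongr
      _ = 4 ^ (-(p - 1)) * 4 ^ (p - 1) * 4 ^ (-(1 / (p - 1))) * (A * A ^ (-1 : ℝ)) := by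
          rw [hd]; ring
      _ = 4 ^ (-(1 / (p - 1))) := by
          rw [← Real.rpow_add (by norm_num), neg_add_cancel, Real.rpow_zero, Real.rpow_neg_one,
            mul_inv_cancel₀ hA0.ne']
          ring
      _ ≤ 1 := b2
  · have := key (1 / (p - 1)) (by positivity) hqp
    calc 4 * A * (2 * (d * a ^ q * A ^ (-q))) ^ (p - 1)
        ≤ 4 * A * (2 * (d * A ^ (-(1 / (p - 1))))) ^ (p - 1) := by gcongr
      _ ≤ 4 * A * (4 ^ (-(1 / (p - 1))) * A ^ (-(1 / (p - 1)))) ^ (p - 1) := by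
          have h2d : 2 * d ≤ 4 ^ (-(1 / (p - 1))) := by
            rw [hd]
            nlinarith
          rw [← mul_assoc]
          gcongr
      _ = 1 := by
          rw [← Real.mul_rpow (by norm_num) hA0.le, ← Real.rpow_mul (by positivity),
            show -(1 / (p - 1)) * (p - 1) = -1 by field_simp, Real.rpow_neg_one,
            mul_inv_cancel₀ (by positivity)]

/-! ### The perturbed weight. -/

theorem div_ofReal_half_mul (V : ℝ≥0∞) {l : ℝ} (hl : 0 < l) :
    V / ENNReal.ofReal (l / 2) * ENNReal.ofReal l = 2 * V := by
  have h0 : ENNReal.ofReal (l / 2) ≠ 0 := by simpa using hl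
  rw [show ENNReal.ofReal l = ENNReal.ofReal (l / 2) * 2 by
    rw [show (2 : ℝ≥0∞) = ENNReal.ofReal 2 by simp, ← ENNReal.ofReal_mul (by positivity)]
    congr 1
    ring, ← mul_assoc, ENNReal.div_mul_cancel h0 ENNReal.ofReal_ne_top, mul_comm]

/-- Puts the right side of the reverse Hölder inequality, with margin l/2, in the form Y^(1+δ) l
required by `lintegral_exp_mul_le`. -/
theorem two_mul_div_rpow_mul (V : ℝ≥0∞) {l δ : ℝ} (hl : 0 < l) (hδ : 0 < δ) :
    2 * (V / ENNReal.ofReal (l / 2)) ^ δ * V =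
      (V / ENNReal.ofReal (l / 2)) ^ (1 + δ) * ENNReal.ofReal l := by
  rw [ENNReal.rpow_add_of_nonneg _ _ zero_le_one hδ.le, ENNReal.rpow_one, mul_right_comm _ _
    (ENNReal.ofReal l), div_ofReal_half_mul V hl]
  ring

/-- The mass of the perturbed weight on an interval. -/
theorem lintegral_exp_mul_weight_le {p : ℝ} (hp : 1 < p) {w b : ℝ → ℝ} (hw : IsWeight w)
    (hb : LocallyIntegrable b volume) {A γ t : ℝ}
    (hA0 : 0 ≤ A) (hA : apPlusConst p w ≤ ENNReal.ofReal A) (hγ : 0 < γ) (hγ1 : γ ≤ 1)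
    (hγA : 2 * A * γ * 4 ^ (p - 1) ≤ 1)
    (hB : bmoNorm (fun x => t * (1 + 1 / (γ / 32)) * b x) ≤ ENNReal.ofReal (1 / 20))
    (x : ℝ) {l : ℝ} (hl : 0 < l) :
    ∫⁻ y in Ioo x (x + l), ENNReal.ofReal (Real.exp (t * b y) * w y) ≤
      ENNReal.ofReal (Real.exp (t * ⨍ y in Ioo x (x + 4 * l), b y)) *
        (96 * ∫⁻ y in Ioo x (x + 3 / 2 * l), ENNReal.ofReal (w y)) := by
  have hR := reverse_holder hw.2 hw.1 (a := x) (d := x + l) (e := x + 3 / 2 * l)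
    (by linarith) (by linarith) hγ hγ1
    (fun α β k _ h2 _ hk h => superlevel_of_apPlus hp hw hA0 hA hγ hγA h2 hk h)
  rw [show x + 3 / 2 * l - (x + l) = l / 2 by ring, two_mul_div_rpow_mul _ hl (by positivity)]
    at hR
  have h := lintegral_exp_mul_le hb (x₀ := x) (x₁ := x + 4 * l)
    hw.2.aestronglyMeasurable.aemeasurable.ennreal_ofReal.restrict (by positivity) hl (by ring)
    (Ioo_subset_Ioo_right (by linarith)) hR hB
  rw [div_ofReal_half_mul _ hl, ← mul_assoc 48, show (48 : ℝ≥0∞) * 2 = 96 by norm_num] at h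
  refine le_of_eq_of_le (lintegral_congr fun y => ?_) h
  rw [ENNReal.ofReal_mul (Real.exp_pos _).le]

/-- Holds for negative `r` and vanishing weight too, since the exponential factor is neither 0 nor
∞. -/
theorem ofReal_exp_mul_rpow {z r : ℝ} (c : ℝ) :
    ENNReal.ofReal (Real.exp z * c) ^ r =
      ENNReal.ofReal (Real.exp (r * z)) * ENNReal.ofReal c ^ r := by
  have h0 : ENNReal.ofReal (Real.exp z) ≠ 0 := by simpa using Real.exp_pos z
  rw [ENNReal.ofReal_mul (Real.exp_pos _).le]
  rcases eq_or_ne (ENNReal.ofReal c) 0 with hc | hc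
  · rw [hc, mul_zero]
    rcases lt_trichotomy r 0 with hr | rfl | hr
    · rw [ENNReal.zero_rpow_of_neg hr, ENNReal.mul_top (by simpa using Real.exp_pos _)]
    · simp
    · rw [ENNReal.zero_rpow_of_pos hr, mul_zero]
  · rw [ENNReal.mul_rpow_of_ne_zero h0 hc, ENNReal.ofReal_rpow_of_pos (Real.exp_pos _),
      ← Real.exp_mul, mul_comm z]

/-- The mass of the dual of the perturbed weight on an interval. -/
theorem lintegral_exp_mul_dual_le {p : ℝ} (hp : 1 < p) {w b : ℝ → ℝ} (hw : IsWeight w)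
    (hb : LocallyIntegrable b volume) {A γ t : ℝ}
    (hA0 : 0 ≤ A) (hA : apPlusConst p w ≤ ENNReal.ofReal A) (hγ : 0 < γ) (hγ1 : γ ≤ 1)
    (hγA : 4 * A * (2 * γ) ^ (p - 1) ≤ 1)
    (hB : bmoNorm (fun x => -(1 / (p - 1)) * t * (1 + 1 / (γ / 32)) * b x) ≤
      ENNReal.ofReal (1 / 20))
    (x : ℝ) {l : ℝ} (hl : 0 < l)
    (hfin : ∫⁻ y in Ioo (x + 3 / 2 * l) (x + 4 * l), ENNReal.ofReal (w y) ^ (-(1 / (p - 1))) ≠ ∞) :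
    ∫⁻ y in Ioo (x + 2 * l) (x + 4 * l),
        ENNReal.ofReal (Real.exp (t * b y) * w y) ^ (-(1 / (p - 1))) ≤
      ENNReal.ofReal (Real.exp (-(1 / (p - 1)) * t * ⨍ y in Ioo x (x + 4 * l), b y)) *
        (96 * ∫⁻ y in Ioo (x + 3 / 2 * l) (x + 4 * l),
          ENNReal.ofReal (w y) ^ (-(1 / (p - 1)))) := by
  set k := 1 / (p - 1)
  set J := Ioo (x + 3 / 2 * l) (x + 4 * l) with hJ
  set σ : ℝ → ℝ≥0∞ := fun y => ENNReal.ofReal (w y) ^ (-k) with hσ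
  have hσm : AEMeasurable σ volume :=
    hw.2.aestronglyMeasurable.aemeasurable.ennreal_ofReal.pow_const _
  -- The dual weight is known to be integrable, hence a.e. finite, only on `J`; the cut-off makes it
  -- a locally integrable real function.
  set s : ℝ → ℝ := J.indicator fun y => (σ y).toReal with hs
  have hs0 : ∀ y, 0 ≤ s y := fun y => indicator_nonneg (fun _ _ => ENNReal.toReal_nonneg) y
  have hsi : LocallyIntegrable s volume :=
    ((integrable_indicator_iff measurableSet_Ioo).2
      (integrable_toReal_of_lintegral_ne_top hσm.restrict hfin)).locallyIntegrable
  have hsσ : ∀ᵐ y, y ∈ J → ENNReal.ofReal (s y) = σ y := by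
    filter_upwards [(ae_restrict_iff' measurableSet_Ioo).1 (ae_lt_top' hσm.restrict hfin)]
      with y hy hyJ
    rw [hs, indicator_of_mem hyJ, ENNReal.ofReal_toReal (hy hyJ).ne]
  have hVe : ∫⁻ y in J, ENNReal.ofReal (s y) = ∫⁻ y in J, σ y :=
    setLIntegral_congr_fun_ae measurableSet_Ioo hsσ
  have hsub : Ioo (x + 2 * l) (x + 4 * l) ⊆ J := Ioo_subset_Ioo_left (by linarith)
  have hR := reverse_holder_reflected hsi hs0 (a := x + 3 / 2 * l) (d := x + 2 * l)
    (e := x + 4 * l) (by linarith) (by linarith) hγ hγ1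
    (fun α β r h1 h2 h3 hr h => superlevel_dual_of_apPlus hp hw hA0 hA hγ hγA hsi hs0 h2 hr
      (by
        filter_upwards [hsσ] with y hy hyαβ
        exact hy (Ioo_subset_Ioo h1 h3 hyαβ)) h)
  rw [show x + 2 * l - (x + 3 / 2 * l) = l / 2 by ring, two_mul_div_rpow_mul _ hl (by positivity)]
    at hR
  have h := lintegral_exp_mul_le hb (x₀ := x) (x₁ := x + 4 * l)
    hsi.aestronglyMeasurable.aemeasurable.ennreal_ofReal.restrict (by positivity) hl (by ring)
    (Ioo_subset_Ioo_left (by linarith)) hR hB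
  rw [div_ofReal_half_mul _ hl, ← mul_assoc 48, show (48 : ℝ≥0∞) * 2 = 96 by norm_num, ← hJ, hVe]
    at h
  refine le_of_eq_of_le (setLIntegral_congr_fun_ae measurableSet_Ioo ?_) h
  filter_upwards [hsσ] with y hy hyJ
  rw [hy (hsub hyJ), ofReal_exp_mul_rpow, ← mul_assoc]

/-- The stability of `A_p^+` under multiplication by the exponential of a function of small `BMO`
norm, for a suitable reverse Hölder exponent. -/
theorem memApPlus_exp_mul {p : ℝ} (hp : 1 < p) {w b : ℝ → ℝ} (hw : MemApPlus p w)
    (hb : LocallyIntegrable b volume) {γ t : ℝ} (hγ : 0 < γ) (hγ1 : γ ≤ 1)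
    (hγA : 2 * (apPlusConst p w).toReal * γ * 4 ^ (p - 1) ≤ 1)
    (hγA' : 4 * (apPlusConst p w).toReal * (2 * γ) ^ (p - 1) ≤ 1)
    (hB : bmoNorm (fun x => t * (1 + 1 / (γ / 32)) * b x) ≤ ENNReal.ofReal (1 / 20))
    (hB' : bmoNorm (fun x => -(1 / (p - 1)) * t * (1 + 1 / (γ / 32)) * b x) ≤
      ENNReal.ofReal (1 / 20)) :
    MemApPlus p (fun x => Real.exp (t * b x) * w x) ∧
      apPlusConst p (fun x => Real.exp (t * b x) * w x) ≤
        ENNReal.ofReal (384 ^ p) * apPlusConst p w := by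
  obtain ⟨hw, hfin⟩ := hw
  have hp1 : 0 < p - 1 := sub_pos.2 hp
  have hA : apPlusConst p w ≤ ENNReal.ofReal (apPlusConst p w).toReal :=
    (ENNReal.ofReal_toReal hfin.ne).ge
  have hA0 : 0 ≤ (apPlusConst p w).toReal := ENNReal.toReal_nonneg
  have hleft := fun x l (hl : 0 < l) =>
    lintegral_exp_mul_weight_le hp hw hb hA0 hA hγ hγ1 hγA hB x hl
  have hWfin : ∀ x y : ℝ, x ≤ y → ∫⁻ z in Ioo x y, ENNReal.ofReal (w z) ≠ ∞ := fun x y hxy => by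
    rw [lintegral_Ioo_ofReal hw.2 hw.1 hxy]; exact ENNReal.ofReal_ne_top
  set v : ℝ → ℝ := fun x => Real.exp (t * b x) * w x with hv
  have hv0 : ∀ x, 0 ≤ v x := fun x => mul_nonneg (Real.exp_pos _).le (hw.1 x)
  have hvm : AEStronglyMeasurable v volume :=
    (Real.continuous_exp.comp_aestronglyMeasurable
      (hb.aestronglyMeasurable.const_mul t)).mul hw.2.aestronglyMeasurable
  have hvi : LocallyIntegrable v volume := by
    intro x
    refine ⟨Ioo (x - 1) (x - 1 + 2), Ioo_mem_nhds (by linarith) (by linarith), hvm.restrict, ?_⟩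
    rw [hasFiniteIntegral_iff_ofReal (ae_of_all _ hv0)]
    refine (hleft (x - 1) 2 two_pos).trans_lt (ENNReal.mul_lt_top ENNReal.ofReal_lt_top
      (ENNReal.mul_lt_top (by simp) ?_))
    exact (hWfin _ _ (by linarith)).lt_top
  have hKt : ENNReal.ofReal (384 ^ p) * apPlusConst p w ≠ ∞ :=
    ENNReal.mul_ne_top ENNReal.ofReal_ne_top hfin.ne
  have hle : apPlusConst p v ≤ ENNReal.ofReal (384 ^ p) * apPlusConst p w := by
    rw [apPlusConst_le_iff hp]
    intro a m c ham hmc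
    refine lintegral_mul_rpow_le_of_gap hp hvi hv0 hKt (fun x l hl => ?_) ham hmc
    have hW := hleft x l hl
    have hAp := (apPlusConst_le_iff hp (w := w)).1 le_rfl x (x + 3 / 2 * l) (x + 4 * l)
      (by linarith) (by linarith)
    rw [show x + 4 * l - x = 4 * l by ring] at hAp
    -- If `w` has no mass on the left, neither has the perturbed weight. Otherwise finiteness of [w]
    -- makes the dual mass on the right finite.
    rcases eq_or_ne (∫⁻ y in Ioo x (x + 3 / 2 * l), ENNReal.ofReal (w y)) 0 with h0 | h0
    · rw [h0, mul_zero, mul_zero, nonpos_iff_eq_zero] at hW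
      rw [hW, zero_mul]
      exact zero_le
    · have hZ : ∫⁻ y in Ioo (x + 3 / 2 * l) (x + 4 * l),
          ENNReal.ofReal (w y) ^ (-(1 / (p - 1))) ≠ ∞ := by
        intro htop
        rw [htop, ENNReal.top_rpow_of_pos hp1, ENNReal.mul_top h0, top_le_iff] at hAp
        exact ENNReal.mul_ne_top hfin.ne
          (ENNReal.rpow_ne_top_of_nonneg (by linarith) ENNReal.ofReal_ne_top) hAp
      have hS := lintegral_exp_mul_dual_le hp hw hb hA0 hA hγ hγ1 hγA' hB' x hl hZ
      set B := ⨍ y in Ioo x (x + 4 * l), b y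
      set W := ∫⁻ y in Ioo x (x + 3 / 2 * l), ENNReal.ofReal (w y)
      set Z := ∫⁻ y in Ioo (x + 3 / 2 * l) (x + 4 * l), ENNReal.ofReal (w y) ^ (-(1 / (p - 1)))
      -- Both mass estimates use the mean of `b` over the same interval (x, x + 4l), so the
      -- exponents cancel.
      have hE : ENNReal.ofReal (Real.exp (t * B)) *
          ENNReal.ofReal (Real.exp (-(1 / (p - 1)) * t * B)) ^ (p - 1) = 1 := by
        rw [ENNReal.ofReal_rpow_of_pos (Real.exp_pos _), ← Real.exp_mul,
          ← ENNReal.ofReal_mul (Real.exp_pos _).le, ← Real.exp_add,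
          show t * B + -(1 / (p - 1)) * t * B * (p - 1) = 0 by field_simp; ring, Real.exp_zero,
          ENNReal.ofReal_one]
      have h96 : (96 : ℝ≥0∞) * 96 ^ (p - 1) = 96 ^ p := by
        nth_rewrite 1 [← ENNReal.rpow_one 96]
        rw [← ENNReal.rpow_add _ _ (by norm_num) (by norm_num), add_sub_cancel]
      calc _ ≤ (ENNReal.ofReal (Real.exp (t * B)) * (96 * W)) *
            (ENNReal.ofReal (Real.exp (-(1 / (p - 1)) * t * B)) * (96 * Z)) ^ (p - 1) := by
            gcongr
        _ = (ENNReal.ofReal (Real.exp (t * B)) *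
              ENNReal.ofReal (Real.exp (-(1 / (p - 1)) * t * B)) ^ (p - 1)) *
            (96 * 96 ^ (p - 1)) * (W * Z ^ (p - 1)) := by
            rw [ENNReal.mul_rpow_of_nonneg _ _ hp1.le, ENNReal.mul_rpow_of_nonneg _ _ hp1.le]
            ring
        _ ≤ 1 * 96 ^ p * (apPlusConst p w * ENNReal.ofReal (4 * l) ^ p) := by
            rw [hE, h96]
            gcongr
        _ = _ := by
            rw [ENNReal.ofReal_mul (by norm_num), ENNReal.mul_rpow_of_nonneg _ _ (by linarith),
              ← ENNReal.ofReal_rpow_of_pos (by norm_num),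
              show (384 : ℝ) = 96 * 4 by norm_num, ENNReal.ofReal_mul (by norm_num),
              ENNReal.mul_rpow_of_nonneg _ _ (by linarith),
              show ENNReal.ofReal 96 = 96 by simp]
            ring
  exact ⟨⟨⟨hv0, hvi⟩, hle.trans_lt hKt.lt_top⟩, hle⟩

theorem memApPlus_of_ae_eq_zero {p : ℝ} (hp : 1 < p) {v : ℝ → ℝ} (hv0 : ∀ x, 0 ≤ v x)
    (hv : v =ᵐ[volume] 0) : MemApPlus p v ∧ apPlusConst p v = 0 := by
  have h : apPlusConst p v = 0 := by
    rw [← nonpos_iff_eq_zero, apPlusConst_le_iff hp]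
    intro a b c _ _
    have h0 : ∫⁻ x in Ioo a b, ENNReal.ofReal (v x) = 0 := by
      rw [lintegral_congr_ae (g := fun _ => 0), lintegral_zero]
      filter_upwards [ae_restrict_of_ae hv] with x hx
      rw [hx, Pi.zero_apply, ENNReal.ofReal_zero]
    rw [h0, zero_mul]
    exact zero_le
  refine ⟨⟨⟨hv0, ?_⟩, by rw [h]; exact ENNReal.zero_lt_top⟩, h⟩
  exact ((integrable_zero ℝ ℝ volume).congr hv.symm).locallyIntegrable

end OneSided

/-! ### Choice of the constants. -/

theorem mainTheorem3 (p : ℝ) (hp : 1 < p) :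
    ∃ ε : ℝ, 0 < ε ∧ ∃ C : ℝ, 0 < C ∧
      ∀ w b : ℝ → ℝ, OneSided.MemApPlus p w → OneSided.MemBMO b →
        ∀ t : ℝ,
          ENNReal.ofReal |t| ≤ ENNReal.ofReal ε /
            (OneSided.apPlusConst p w ^ (max 1 (1 / (p - 1))) * OneSided.bmoNorm b) →
          OneSided.MemApPlus p (fun x => Real.exp (t * b x) * w x) ∧
            OneSided.apPlusConst p (fun x => Real.exp (t * b x) * w x) ≤
              ENNReal.ofReal C * OneSided.apPlusConst p w := by
  have hp1 : 0 < p - 1 := sub_pos.2 hp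
  obtain ⟨c, hc, hexp⟩ := OneSided.exists_exponent hp
  set q := max 1 (1 / (p - 1)) with hq
  have hq1 : 1 ≤ q := le_max_left _ _
  have hqk : 1 / (p - 1) ≤ q := le_max_right _ _
  have hq0 : 0 < q := zero_lt_one.trans_le hq1
  -- 660 = 33 · 20: the conjugate exponent 1 + 32/γ is at most 33/γ, and the norm must drop below
  -- 1/20. The factor `q` covers both multipliers t and -t/(p-1). In 384 = 96 · 4, 96 is the loss in
  -- each mass and 4 the length ratio.
  refine ⟨c / (660 * q), by positivity, 384 ^ p, by positivity, fun w b hw hb t ht => ?_⟩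
  -- For the zero weight [w] = 0, so there is no lower bound on [w] and no restriction on `t`; the
  -- claim is then trivial.
  by_cases hw0 : w =ᵐ[volume] 0
  · obtain ⟨h1, h2⟩ := OneSided.memApPlus_of_ae_eq_zero hp
      (v := fun x => Real.exp (t * b x) * w x)
      (fun x => mul_nonneg (Real.exp_pos _).le (hw.1.1 x))
      (by filter_upwards [hw0] with x hx; simp [hx])
    exact ⟨h1, by rw [h2]; exact zero_le⟩
  set A := (OneSided.apPlusConst p w).toReal with hA
  have hAe : OneSided.apPlusConst p w = ENNReal.ofReal A := (ENNReal.ofReal_toReal hw.2.ne).symm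
  have hAlow := OneSided.le_of_apPlusConst_le hp hw.1 ENNReal.toReal_nonneg hAe.le hw0
  have hA0 : 0 < A := lt_of_lt_of_le (by positivity) hAlow
  obtain ⟨g1, g2, g3⟩ := hexp A hAlow
  set γ := c * A ^ (-q) with hγ
  have hγ0 : 0 < γ := by positivity
  have hr : 1 + 1 / (γ / 32) ≤ 33 / c * A ^ q := by
    have e : 33 / c * A ^ q = 33 / γ := by
      rw [hγ, Real.rpow_neg hA0.le]
      field_simp
    rw [e, one_div_div, le_div_iff₀ hγ0, add_mul, div_mul_cancel₀ _ hγ0.ne']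
    linarith
  have ht' := ENNReal.mul_le_of_le_div ht
  have hsmall : ∀ u : ℝ, |u| ≤ q * |t| →
      OneSided.bmoNorm (fun x => u * (1 + 1 / (γ / 32)) * b x) ≤ ENNReal.ofReal (1 / 20) := by
    intro u hu
    have habs : |u * (1 + 1 / (γ / 32))| ≤ 33 * q / c * (|t| * A ^ q) := by
      rw [abs_mul, abs_of_pos (show 0 < 1 + 1 / (γ / 32) by positivity)]
      calc |u| * (1 + 1 / (γ / 32)) ≤ q * |t| * (33 / c * A ^ q) := by gcongr
        _ = _ := by ring
    calc OneSided.bmoNorm (fun x => u * (1 + 1 / (γ / 32)) * b x)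
        ≤ ENNReal.ofReal |u * (1 + 1 / (γ / 32))| * OneSided.bmoNorm b :=
          OneSided.bmoNorm_mul_le _
      _ ≤ ENNReal.ofReal (33 * q / c * (|t| * A ^ q)) * OneSided.bmoNorm b := by gcongr
      _ = ENNReal.ofReal (33 * q / c) *
          (ENNReal.ofReal |t| * (OneSided.apPlusConst p w ^ q * OneSided.bmoNorm b)) := by
          rw [hAe, ENNReal.ofReal_rpow_of_pos hA0, ENNReal.ofReal_mul (by positivity),
            ENNReal.ofReal_mul (abs_nonneg t)]
          ring
      _ ≤ ENNReal.ofReal (33 * q / c) * ENNReal.ofReal (c / (660 * q)) := by gcongr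
      _ = ENNReal.ofReal (1 / 20) := by
          rw [← ENNReal.ofReal_mul (by positivity)]
          congr 1
          field_simp
          norm_num
  refine OneSided.memApPlus_exp_mul hp hw hb.1 hγ0 g1 g2 g3 (hsmall t ?_) (hsmall _ ?_)
  · exact le_mul_of_one_le_left (abs_nonneg t) hq1
  · rw [abs_mul, abs_neg, abs_of_pos (show 0 < 1 / (p - 1) by positivity)]
    gcongr
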